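/- There is a universal constant $C>0$ such that the following holds. Let $M=(\mathcal S,s_0,g,\mathcal A,P)$ be a known MDP with finite state space $\mathcal S$, initial state $s_0\in\mathcal S$, goal state $g\notin\mathcal S$, finite action sets $\mathcal A_s$, set of pairs $\Gamma=\{(s,a):s\in\mathcal S,a\in\mathcal A_s\}$, and transition probabilities $P(\cdot|s,a)$ on $\mathcal S\cup\{g\}$. Put $S=|\mathcal S|$ and $A=|\Gamma|/S$, so that $SA=|\Gamma|$. A deterministic stationary policy is proper if from every state it reaches $g$ almost surely; assume that a proper policy exists. $T^\pi(s)$ is the expected number of steps in which $\pi$ reaches $g$ from $s$, $D=\max_s\min_{\pi\text{ proper}}T^\pi(s)$, and $\pi^f$ is a proper policy with $T^{\pi^f}(s)\le T^\pi(s)$ for all $s$ and all proper $\pi$. An oblivious adversary fixes cost functions $c_1,c_2,\dots:\Gamma\to[0,1]$ in advance. $J_k^\pi(s)$ is the expected total cost of $\pi$ from $s$ under $c_k$, $\pi^\star$ is any minimizer of $\sum_{k=1}^KJ_k^\pi(s_0)$ over the proper deterministic policies, and $T_\star=T^{\pi^\star}(s_0)$, $T_{\max}=\max_sT^{\pi^\star}(s)$.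 *Loop-free instance.* Let $H=H_1+H_2$ and let $\widetilde\Gamma=\Gamma\cup\{(s_f,a_f)\}$ with an additional "fast" state $s_f$ with single action $a_f$, of cost $c_k(s_f,a_f)=1$. Let $\widetilde\Delta(T)$ be the set of $q:\widetilde\Gamma\times[H]\to[0,1]$ with $\sum_{h\le H}\sum_{(s,a)\in\widetilde\Gamma}q(s,a,h)\le T$; $\sum_aq(s_0,a,1)=1$ and $q(s,a,1)=0$ for $s\in\mathcal S\setminus\{s_0\}$; $q(s,a,h)=0$ for $(s,a)\in\Gamma$, $h>H_1$; $q(s_f,a_f,h)=\mathbb 1\{h>H_1\}\sum_{(s,a)\in\Gamma}q(s,a,H_1)$; and $\sum_aq(s,a,h)=\sum_{(s',a')\in\Gamma}P(s|s',a')q(s',a',h-1)$ for $s\in\mathcal S$, $1<h\le H_1$. For a function $f(s,a,h)$ write $f(s,a)=\sum_hf(s,a,h)$. *Algorithm (log-barrier policy search).* Parameters: $T$, $\tau$, $H_1$, $H_2$, $\eta=\sqrt{SA/(D\tau K)}$ and $\lambda=8\eta$. Write $\phi_q(s,a,h)=(1+\lambda h)\,q(s,a,h)$ for the skewed occupancy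 measure of $q$, and $\psi(\phi)=\frac1\eta\sum_{(s,a)\in\widetilde\Gamma}\ln\frac1{\phi(s,a)}$ with Bregman divergence $D_\psi$; pairs $(s,a)$ at which every $q\in\widetilde\Delta(T)$ has $q(s,a)=0$ are left out of the sum (they can be removed from the instance). The first point $q_1$ minimizes $\psi(\phi_q)$ over $q\in\widetilde\Delta(T)$. In episode $k$ the learner starts at $s_0$; in steps $h\le H_1$ it plays $a$ at state $s$ with probability proportional to $q_k(s,a,h)$, and afterwards it plays $\pi^f$ until $g$ is reached. Only the costs of the visited pairs are observed. With $\widetilde N_k(s,a)$ the number of visits to $(s,a)$ in the first $H_1$ steps, and $\widetilde N_k(s_f,a_f)=H_2$ if $g$ has not been reached before step $H_1$ and $0$ otherwise, put $\widehat c_k(s,a)=\widetilde N_k(s,a)c_k(s,a)/q_k(s,a)$. Then $q_{k+1}$ is a minimizer over $q\in\widetilde\Delta(T)$ of $\sum_{(s,a)\in\widetilde\Gamma}\phi_q(s,a)\widehat c_k(s,a)+D_\psi(\phi_q,\phi_{q_k})$. Ties among minimizers are broken by an arbitrary fixed rule. *Claim.* Suppose $T\ge T_\star+1$, $\tau\ge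 T_\star$, $H_1\ge 8T_{\max}\ln K$, $H_2\ge D$ and $K\ge 64\,SA\,H^2$. Then almost surely each of the $K$ episodes ends after finitely many steps $I_k$, and the regret $R_K=\sum_{k=1}^K\sum_{i=1}^{I_k}c_k(s_k^i,a_k^i)-\sum_{k=1}^KJ_k^{\pi^\star}(s_0)$ is integrable with $$\mathbb E[R_K]\le C\sqrt{D\,\tau\,SAK}\;\ln(TK).$$ In particular $\mathbb E[R_K]=\widetilde O(\sqrt{DT_\star SAK})$ if the learning rate is tuned with $\tau=T_\star$ (for every $T\ge T_\star+1$), or with $\tau=T=T_\star+1$; with $\tau=T$ the bound is $\widetilde O(\sqrt{DTSAK})$. -/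

import Mathlib

open MeasureTheory ProbabilityTheory
open scoped ENNReal

noncomputable section

namespace SSP

universe u v

/-- A state-action pair while the episode is running; `none` once the goal has been reached. -/
abbrev Step {S : Type u} (A : S → Type v) : Type (max u v) := Option (Σ s, A s)

instance {S : Type u} (A : S → Type v) : MeasurableSpace (Step A) := ⊤

/-- The trajectory of one episode. The entry with index `i` is step `i + 1` of the episode, and the
entries are `none` from the step on at which the goal has been reached. -/
abbrev Traj {S : Type u} (A : S → Type v) : Type (max u v) := ℕ → Step A

/-- An MDP with states `S`, action set `A s` available at `s`, goal `none : Option S`, initial state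
`s₀` and transition function `P`. -/
structure MDP (S : Type u) (A : S → Type v) where
  s₀ : S
  P : (Σ s, A s) → PMF (Option S)

/-- A Markov policy: a distribution over the available actions for each step and each state. -/
abbrev Policy {S : Type u} (A : S → Type v) : Type (max u v) := ℕ → (s : S) → PMF (A s)

/-- The stationary deterministic policy that takes action `f s` at `s`. -/
def detPolicy {S : Type u} {A : S → Type v} (f : (s : S) → A s) : Policy A :=
  fun _ s => PMF.pure (f s)

section Model

variable {S : Type u} {A : S → Type v}

/-- Law of the entry with index `i` of the trajectory, given that the current state is `x`. -/
def act (π : Policy A) (i : ℕ) : Option S → PMF (Step A)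
  | none => PMF.pure none
  | some s => (π i s).map fun a => some ⟨s, a⟩

namespace MDP

/-- Law of the entry with index `i + 1`, given the entry with index `i`. The goal is absorbing. -/
def step (M : MDP S A) (π : Policy A) (i : ℕ) : Step A → PMF (Step A)
  | none => PMF.pure none
  | some γ => (M.P γ).bind (act π (i + 1))

variable [Fintype S] [∀ s, Fintype (A s)]

/-- The kernel from the entries with index at most `n` to the entry with index `n + 1`. -/
def stepKernel (M : MDP S A) (π : Policy A) (n : ℕ) :
    Kernel ((i : Finset.Iic n) → Step A) (Step A) :=
  (Kernel.ofFunOfCountable fun x : Step A => (M.step π n x).toMeasure).comap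
    (fun h => h ⟨n, Finset.mem_Iic.2 le_rfl⟩) (measurable_pi_apply _)

instance (M : MDP S A) (π : Policy A) (n : ℕ) : IsMarkovKernel (M.stepKernel π n) :=
  ⟨fun h => inferInstanceAs
    (IsProbabilityMeasure (M.step π n (h ⟨n, Finset.mem_Iic.2 le_rfl⟩)).toMeasure)⟩

/-- Law of the trajectory of an episode in which `π` is executed starting from state `s`. -/
def episodeLaw (M : MDP S A) (π : Policy A) (s : S) : Measure (Traj A) :=
  Kernel.trajMeasure (X := fun _ : ℕ => Step A) (act π 0 (some s)).toMeasure (M.stepKernel π)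

instance (M : MDP S A) (π : Policy A) (s : S) : IsProbabilityMeasure (M.episodeLaw π s) := by
  unfold episodeLaw; infer_instance

/-- Executed from any state, the deterministic policy `f` reaches the goal almost surely. -/
def Proper (M : MDP S A) (f : (s : S) → A s) : Prop :=
  ∀ s, ∀ᵐ τ ∂M.episodeLaw (detPolicy f) s, ∃ i, τ i = none

end MDP

/-- The cost of one step; nothing is paid once the goal has been reached. -/
def stepCost (c : (Σ s, A s) → ℝ) : Step A → ℝ
  | none => 0
  | some γ => c γ

namespace MDP

variable [Fintype S] [∀ s, Fintype (A s)]

/-- The cost-to-go function of the deterministic policy `f`. -/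
def costToGo (M : MDP S A) (c : (Σ s, A s) → ℝ) (f : (s : S) → A s) (s : S) : ℝ≥0∞ :=
  ∫⁻ τ, ∑' i, ENNReal.ofReal (stepCost c (τ i)) ∂M.episodeLaw (detPolicy f) s

/-- The expected hitting time of the goal: the expected number of steps of the episode. -/
def hittingTime (M : MDP S A) (f : (s : S) → A s) (s : S) : ℝ≥0∞ :=
  M.costToGo (fun _ => 1) f s

/-- The diameter: the largest, over the states, of the smallest expected hitting time of a proper
deterministic policy. -/
def diameter (M : MDP S A) : ℝ≥0∞ :=
  ⨆ s, ⨅ f : {f : (s : S) → A s // M.Proper f}, M.hittingTime f.1 s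

/-- A fast policy: it has the smallest expected hitting time from every state. -/
def IsFast (M : MDP S A) (f : (s : S) → A s) : Prop :=
  M.Proper f ∧ ∀ g, M.Proper g → ∀ s, M.hittingTime f s ≤ M.hittingTime g s

/-- A best proper deterministic policy in hindsight for the first `K` cost functions. -/
def IsBest (M : MDP S A) (c : ℕ → (Σ s, A s) → ℝ) (K : ℕ) (f : (s : S) → A s) : Prop :=
  M.Proper f ∧ ∀ g, M.Proper g →
    ∑ k ∈ Finset.range K, M.costToGo (c k) f M.s₀ ≤ ∑ k ∈ Finset.range K, M.costToGo (c k) g M.s₀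

/-- The regret of a run of the learner (`ω k` is the trajectory of episode `k`) in the first `K`
episodes, against the policy `f`. -/
def regret (M : MDP S A) (c : ℕ → (Σ s, A s) → ℝ) (K : ℕ) (f : (s : S) → A s)
    (ω : ℕ → Traj A) : ℝ :=
  ∑ k ∈ Finset.range K, ∑' i, stepCost (c k) (ω k i)
    - ∑ k ∈ Finset.range K, (M.costToGo (c k) f M.s₀).toReal

end MDP

/-! ### The loop-free instance and its occupancy measures

The loop-free instance has layers `1, …, H₁ + H₂` and an additional state with a single action, the
fast state. Its state-action pairs in a layer are `Option (Σ s, A s)`, where `none` is the pair of the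
fast state. In layers `1, …, H₁` it follows the MDP; every pair of layer `H₁` leads to the fast
state, which is then visited in all the layers `H₁ + 1, …, H₁ + H₂`, and costs `1` each time.
Functions on pairs and layers have type `Option (Σ s, A s) → ℕ → ℝ`, where the second argument `i`
stands for layer `i + 1`. -/

/-- Functions on the state-action pairs and layers of the loop-free instance. -/
abbrev Occ {S : Type u} (A : S → Type v) : Type (max u v) := Option (Σ s, A s) → ℕ → ℝ

/-- Sum over the layers. -/
def marginal (H : ℕ) (q : Occ A) (γ : Option (Σ s, A s)) : ℝ := ∑ i ∈ Finset.range H, q γ i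

/-- The skewed occupancy measure `q + lam • (h ∘ q)`, where `(h ∘ q) (s, a, h) = h * q (s, a, h)`. -/
def skew (lam : ℝ) (q : Occ A) : Occ A := fun γ i => q γ i + lam * (((i : ℝ) + 1) * q γ i)

variable [Fintype S] [∀ s, Fintype (A s)]

open Classical in
/-- `q` is an occupancy measure of the loop-free instance with total expected time at most `T`. -/
structure IsLoopFreeOcc (M : MDP S A) (H₁ H₂ : ℕ) (T : ℝ) (q : Occ A) : Prop where
  mem_unit : ∀ γ i, q γ i ∈ Set.Icc (0 : ℝ) 1
  layers : ∀ γ i, H₁ + H₂ ≤ i → q γ i = 0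
  total : ∑ γ, marginal (H₁ + H₂) q γ ≤ T
  initial : ∑ a, q (some ⟨M.s₀, a⟩) 0 = 1
  initial_ne : ∀ s a, s ≠ M.s₀ → q (some ⟨s, a⟩) 0 = 0
  late : ∀ γ i, H₁ ≤ i → q (some γ) i = 0
  fast : ∀ i, i < H₁ + H₂ →
    q none i = if H₁ ≤ i then ∑ γ : (Σ s, A s), q (some γ) (H₁ - 1) else 0
  flow : ∀ s i, i + 1 < H₁ →
    ∑ a, q (some ⟨s, a⟩) (i + 1) = ∑ γ : (Σ s, A s), (M.P γ (some s)).toReal * q (some γ) i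

/-- The pairs of the loop-free instance that some occupancy measure visits. On the other pairs all
occupancy measures vanish, so that they can be removed from the instance. -/
def active (M : MDP S A) (H₁ H₂ : ℕ) (T : ℝ) : Set (Option (Σ s, A s)) :=
  {γ | ∃ q : Occ A, IsLoopFreeOcc M H₁ H₂ T q ∧ 0 < marginal (H₁ + H₂) q γ}

open Classical in
/-- The log-barrier regularizer, as a function of the sums over the layers. -/
def logBarrier (M : MDP S A) (H₁ H₂ : ℕ) (T η : ℝ) (φ : Option (Σ s, A s) → ℝ) : ℝ :=
  1 / η * ∑ γ with γ ∈ active M H₁ H₂ T, Real.log (1 / φ γ)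

/-- The Bregman divergence. -/
def bregman (ψ : (Option (Σ s, A s) → ℝ) → ℝ) (φ φ' : Option (Σ s, A s) → ℝ) : ℝ :=
  ψ φ - ψ φ' - fderiv ℝ ψ φ' (φ - φ')

/-- The occupancy measures at which the log-barrier is finite. -/
def Feasible (M : MDP S A) (H₁ H₂ : ℕ) (T : ℝ) : Set (Occ A) :=
  {q | IsLoopFreeOcc M H₁ H₂ T q ∧ ∀ γ ∈ active M H₁ H₂ T, 0 < marginal (H₁ + H₂) q γ}

/-- The objective of online mirror descent at the skewed occupancy measure of `p`, given the current
point `q` and the cost estimator `chat`. -/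
def omdObjective (M : MDP S A) (H₁ H₂ : ℕ) (T η lam : ℝ) (q : Occ A)
    (chat : Option (Σ s, A s) → ℝ) (p : Occ A) : ℝ :=
  ∑ γ, marginal (H₁ + H₂) (skew lam p) γ * chat γ
    + bregman (logBarrier M H₁ H₂ T η)
        (marginal (H₁ + H₂) (skew lam p)) (marginal (H₁ + H₂) (skew lam q))

/-- `q₁` and `upd` carry out the minimizations of online mirror descent with the log-barrier over the
skewed occupancy measures: `q₁` is a minimizer of the regularizer, and `upd q chat` is a minimizer of
the objective with current point `q` and cost estimator `chat`. Minimizers need not be unique; ties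
are broken by `q₁` and `upd`. -/
structure IsOMD (M : MDP S A) (H₁ H₂ : ℕ) (T η lam : ℝ) (q₁ : Occ A)
    (upd : Occ A → (Option (Σ s, A s) → ℝ) → Occ A) : Prop where
  init : IsMinOn
    (fun p => logBarrier M H₁ H₂ T η (marginal (H₁ + H₂) (skew lam p))) (Feasible M H₁ H₂ T) q₁
  init_mem : q₁ ∈ Feasible M H₁ H₂ T
  update : ∀ q ∈ Feasible M H₁ H₂ T, ∀ chat : Option (Σ s, A s) → ℝ, (∀ γ, 0 ≤ chat γ) →
    IsMinOn (omdObjective M H₁ H₂ T η lam q chat) (Feasible M H₁ H₂ T) (upd q chat)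
  update_mem : ∀ q ∈ Feasible M H₁ H₂ T, ∀ chat : Option (Σ s, A s) → ℝ, (∀ γ, 0 ≤ chat γ) →
    upd q chat ∈ Feasible M H₁ H₂ T

open Classical in
/-- The policy of the MDP that plays, in the first `H₁` steps, action `a` at state `s` in step `h` with
probability proportional to `q (s, a, h)`, and then the fast policy `πf` until the goal is reached.
The states with `q (s, ·, h) = 0` are never met; `πf` is used there as well. -/
def execPolicy (H₁ : ℕ) (πf : (s : S) → A s) (q : Occ A) : Policy A := fun i s =>
  if h : i < H₁ ∧ ∑' a, ENNReal.ofReal (q (some ⟨s, a⟩) i) ≠ 0 then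
    PMF.normalize (fun a => ENNReal.ofReal (q (some ⟨s, a⟩) i)) h.2
      (by rw [tsum_fintype]; exact ENNReal.sum_ne_top.2 fun _ _ => ENNReal.ofReal_ne_top)
  else PMF.pure (πf s)

open Classical in
/-- The number (`0` or `1`) of visits to a pair in a layer of the loop-free instance, read off from the
first `H₁` steps of the trajectory `τ` in the MDP: the fast state is visited in the layers after `H₁`
when the goal is not reached before step `H₁`. -/
def visits (H₁ H₂ : ℕ) (τ : Traj A) : Occ A
  | some γ, i => if i < H₁ ∧ τ i = some γ then 1 else 0
  | none, i => if H₁ ≤ i ∧ i < H₁ + H₂ ∧ τ (H₁ - 1) ≠ none then 1 else 0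

/-- The costs of the loop-free instance. -/
def loopFreeCost (c : (Σ s, A s) → ℝ) : Option (Σ s, A s) → ℝ
  | none => 1
  | some γ => c γ

/-- The importance-weighted cost estimator. It uses the costs of visited pairs only. -/
def estimator (H₁ H₂ : ℕ) (c : (Σ s, A s) → ℝ) (q : Occ A) (τ : Traj A)
    (γ : Option (Σ s, A s)) : ℝ :=
  marginal (H₁ + H₂) (visits H₁ H₂ τ) γ * loopFreeCost c γ / marginal (H₁ + H₂) q γ

/-- The point of online mirror descent with which the learner plays episode `k` (counted from `0`),
as a function of the trajectories of the episodes before `k`. -/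
def iterate (H₁ H₂ : ℕ) (q₁ : Occ A) (upd : Occ A → (Option (Σ s, A s) → ℝ) → Occ A)
    (c : ℕ → (Σ s, A s) → ℝ) : ℕ → (ℕ → Traj A) → Occ A
  | 0, _ => q₁
  | k + 1, ω =>
    upd (iterate H₁ H₂ q₁ upd c k ω)
      (estimator H₁ H₂ (c k) (iterate H₁ H₂ q₁ upd c k ω) (ω k))

/-- The trajectories with entries `y k i`, continued by `none`. -/
def extend {H₁ n : ℕ} (y : Finset.Iic n → Fin H₁ → Step A) : ℕ → Traj A := fun k i =>
  if h : k ≤ n ∧ i < H₁ then y ⟨k, Finset.mem_Iic.2 h.1⟩ ⟨i, h.2⟩ else none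

/-- The kernel from the trajectories of the episodes `0, …, n` to the trajectory of episode `n + 1`.
The learner's point depends on the first `H₁` steps of the earlier episodes only. -/
def episodeKernel (M : MDP S A) (H₁ H₂ : ℕ) (πf : (s : S) → A s) (q₁ : Occ A)
    (upd : Occ A → (Option (Σ s, A s) → ℝ) → Occ A) (c : ℕ → (Σ s, A s) → ℝ) (n : ℕ) :
    Kernel ((i : Finset.Iic n) → Traj A) (Traj A) :=
  (Kernel.ofFunOfCountable fun y : Finset.Iic n → Fin H₁ → Step A =>
      M.episodeLaw (execPolicy H₁ πf (iterate H₁ H₂ q₁ upd c (n + 1) (extend y))) M.s₀).comap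
    (fun x k i => x k i) (by fun_prop)

instance (M : MDP S A) (H₁ H₂ : ℕ) (πf : (s : S) → A s) (q₁ : Occ A)
    (upd : Occ A → (Option (Σ s, A s) → ℝ) → Occ A) (c : ℕ → (Σ s, A s) → ℝ) (n : ℕ) :
    IsMarkovKernel (episodeKernel M H₁ H₂ πf q₁ upd c n) :=
  ⟨fun x => inferInstanceAs (IsProbabilityMeasure (M.episodeLaw (execPolicy H₁ πf
    (iterate H₁ H₂ q₁ upd c (n + 1) (extend fun k i => x k i))) M.s₀))⟩

/-- The law of the trajectories of all the episodes, when the learner executes in each episode the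
policy of the current point of online mirror descent. -/
def runLaw (M : MDP S A) (H₁ H₂ : ℕ) (πf : (s : S) → A s) (q₁ : Occ A)
    (upd : Occ A → (Option (Σ s, A s) → ℝ) → Occ A) (c : ℕ → (Σ s, A s) → ℝ) :
    Measure (ℕ → Traj A) :=
  Kernel.trajMeasure (X := fun _ : ℕ => Traj A) (M.episodeLaw (execPolicy H₁ πf q₁) M.s₀)
    (episodeKernel M H₁ H₂ πf q₁ upd c)

instance (M : MDP S A) (H₁ H₂ : ℕ) (πf : (s : S) → A s) (q₁ : Occ A)
    (upd : Occ A → (Option (Σ s, A s) → ℝ) → Occ A) (c : ℕ → (Σ s, A s) → ℝ) :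
    IsProbabilityMeasure (runLaw M H₁ H₂ πf q₁ upd c) := by
  unfold runLaw; infer_instance

end Model

end SSP

end

/-! Everything is linear in occupancy measures, and the skew `1 + lam * h` makes the second-order
error of mirror descent cancel.

Reduction. A point `q` of the polytope gives the exact visit probabilities of its policy in the
first `H₁` steps (`IsLoopFreeOcc.occ_execPolicy`). From then on the fast policy takes at most `D ≤
H₂` steps in expectation, and the fast state charges `H₂` for the surviving mass. So the expected
cost of an episode is at most the loop-free cost `⟨q, c⟩` (`lintegral_cost_execPolicy_le`).

Mirror descent. With the log-barrier, one update satisfies `⟨φ_q - φ_u, chat⟩ - η * ∑ (φ_q * chat) ^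
2 ≤ Div(u, old) - Div(u, new)` for every nonnegative loss (`omd_step`), and the right side
telescopes. Since `lam * H ≤ 1`, `φ_q ≤ 2 q` cancels the importance weight, and the square of a
visit count is at most twice the sum of the visit times. Hence the squared term has conditional
expectation at most `8 η ∑ h q c = lam ∑ h q c = ⟨φ_q - q, c⟩`, precisely the price of the skew.
What remains is `⟨q, c⟩ ≤ E[gain] + ⟨φ_u, c⟩` (`integral_omdGain_ge`): the variance is paid by the
comparator.

Comparator. The extra cost is `lam` times the costs of the best policy weighted by time. Summation
by parts turns these into a sum over time of expected costs-to-go. They would be at most `K * D` for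
a policy optimal from every state, but the best policy is optimal from `s₀` only, and zero-cost
loops may obstruct a Bellman-optimal proper policy. Adding `1` to the total cost yields such a
policy, and the best policy's excess over it is an excessive function with value at most `Tstar` at
`s₀` (`MDP.IsBest.sum_weighted_le`). The hypothesis on `H₁` makes survival beyond it so unlikely
that the truncated best policy lies in the polytope (`MDP.Proper.next_pow_one_le`).

Balance. The comparator is mixed with weight `1 / (T * K)` on `q₁`, which keeps its divergence from
`q₁` at most `(SA + 1) / η * log (T * K)` at constant cost. The chosen `η` balances this against
`lam * K * D * Tstar`. -/

noncomputable section

namespace SSP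

universe u v

section

/-! ### Trajectory measures: conditioning on the past -/

section TrajMeasure

variable {X : ℕ → Type*} [∀ n, MeasurableSpace (X n)] (μ₀ : Measure (X 0))
  (κ : (n : ℕ) → Kernel ((i : Finset.Iic n) → X i) (X (n + 1)))
  [∀ n, IsMarkovKernel (κ n)]

theorem map_eval_zero_trajMeasure :
    (Kernel.trajMeasure μ₀ κ).map (fun x => x 0) = μ₀ := by
  have h : (fun x : (n : ℕ) → X n => x 0)
      = (MeasurableEquiv.piUnique (fun i : Finset.Iic 0 => X i)) ∘ Preorder.frestrictLe 0 := by
    ext x; rfl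
  have h2 : (Kernel.trajMeasure μ₀ κ).map (Preorder.frestrictLe 0)
      = μ₀.map (MeasurableEquiv.piUnique (fun i : Finset.Iic 0 => X i)).symm := by
    rw [Kernel.trajMeasure, Measure.map_comp _ _ (by fun_prop), Kernel.traj_map_frestrictLe,
      Kernel.partialTraj_self, Measure.id_comp]
    rfl
  rw [h]
  refine (Measure.map_map (MeasurableEquiv.piUnique (fun i : Finset.Iic 0 => X i)).measurable
    (Preorder.measurable_frestrictLe 0)).symm.trans ?_
  rw [h2]
  exact MeasurableEquiv.map_map_symm _

variable [IsProbabilityMeasure μ₀]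

/-- The law of the entries up to `n + 1` is the composition product of the law of the past with `κ
n`. The Markov property within an episode and the conditioning between episodes both rest on this
identity or on its real-valued version. -/
theorem lintegral_trajMeasure_succ (n : ℕ)
    {F : ((i : Finset.Iic n) → X i) × X (n + 1) → ℝ≥0∞} (hF : Measurable F) :
    ∫⁻ x, F (Preorder.frestrictLe n x, x (n + 1)) ∂Kernel.trajMeasure μ₀ κ
      = ∫⁻ x, ∫⁻ y, F (Preorder.frestrictLe n x, y) ∂κ n (Preorder.frestrictLe n x)
          ∂Kernel.trajMeasure μ₀ κ := by
  rw [← lintegral_map (f := F) (g := fun x : (n : ℕ) → X n => (Preorder.frestrictLe n x, x (n + 1)))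
    hF (by fun_prop),
    ← Kernel.map_frestrictLe_trajMeasure_compProd_eq_map_trajMeasure,
    Measure.lintegral_compProd hF, lintegral_map _ (by fun_prop)]
  exact hF.lintegral_kernel_prod_right'

theorem integral_trajMeasure_succ (n : ℕ)
    {F : ((i : Finset.Iic n) → X i) × X (n + 1) → ℝ} (hF : Measurable F)
    (hi : Integrable (fun x => F (Preorder.frestrictLe n x, x (n + 1))) (Kernel.trajMeasure μ₀ κ)) :
    ∫ x, F (Preorder.frestrictLe n x, x (n + 1)) ∂Kernel.trajMeasure μ₀ κ
      = ∫ x, ∫ y, F (Preorder.frestrictLe n x, y) ∂κ n (Preorder.frestrictLe n x)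
          ∂Kernel.trajMeasure μ₀ κ := by
  have hm : Measurable (fun x : (n : ℕ) → X n => (Preorder.frestrictLe n x, x (n + 1))) := by
    fun_prop
  have hi' : Integrable F
      ((Kernel.trajMeasure μ₀ κ).map (fun x => (Preorder.frestrictLe n x, x (n + 1)))) :=
    (integrable_map_measure hF.aestronglyMeasurable hm.aemeasurable).2 hi
  rw [← integral_map (f := F) (φ := fun x : (n : ℕ) → X n => (Preorder.frestrictLe n x, x (n + 1)))
    hm.aemeasurable hF.aestronglyMeasurable]
  rw [← Kernel.map_frestrictLe_trajMeasure_compProd_eq_map_trajMeasure] at hi' ⊢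
  rw [Measure.integral_compProd hi', integral_map (by fun_prop)]
  exact hF.stronglyMeasurable.integral_kernel_prod_right'.aestronglyMeasurable

end TrajMeasure

/-! ### Occupancy probabilities of one episode -/

variable {S : Type u} {A : S → Type v}

open Classical in
theorem act_some_apply (π : Policy A) (i : ℕ) (s : S) (γ : Σ s, A s) :
    act π i (some s) (some γ) = if γ.1 = s then π i γ.1 γ.2 else 0 := by
  obtain ⟨s', a⟩ := γ
  simp only [act, PMF.map_apply]
  split_ifs with h
  · subst h
    rw [tsum_eq_single a]
    · simp
    · intro b hb
      rw [if_neg]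
      intro h
      simp only [Option.some.injEq, Sigma.mk.injEq, heq_eq_eq, true_and] at h
      exact hb h.symm
  · refine ENNReal.tsum_eq_zero.2 fun b => if_neg fun hb => h ?_
    simp only [Option.some.injEq, Sigma.mk.injEq] at hb
    exact hb.1

theorem act_none_apply (π : Policy A) (i : ℕ) (γ : Σ s, A s) :
    act π i none (some γ) = 0 := by
  simp [act]

theorem MDP.step_none_apply (M : MDP S A) (π : Policy A) (i : ℕ) (γ : Σ s, A s) :
    M.step π i none (some γ) = 0 := by
  simp [MDP.step]

theorem MDP.step_some_apply (M : MDP S A) (π : Policy A) (i : ℕ) (γ' γ : Σ s, A s) :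
    M.step π i (some γ') (some γ) = M.P γ' (some γ.1) * π (i + 1) γ.1 γ.2 := by
  simp only [MDP.step, PMF.bind_apply]
  rw [tsum_eq_single (some γ.1)]
  · rw [act_some_apply, if_pos rfl]
  · rintro (_ | s) hs
    · rw [act_none_apply, mul_zero]
    · rw [act_some_apply, if_neg (fun h => hs (by rw [h])), mul_zero]

variable [Fintype S] [∀ s, Fintype (A s)]

namespace MDP

theorem lintegral_episodeLaw_succ (M : MDP S A) (π : Policy A) (s : S) (n : ℕ)
    (F : Step A → Step A → ℝ≥0∞) :
    ∫⁻ τ, F (τ n) (τ (n + 1)) ∂M.episodeLaw π s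
      = ∫⁻ τ, ∫⁻ y, F (τ n) y ∂(M.step π n (τ n)).toMeasure ∂M.episodeLaw π s := by
  have hF : Measurable (fun p : ((i : Finset.Iic n) → Step A) × Step A =>
      F (p.1 ⟨n, Finset.mem_Iic.2 le_rfl⟩) p.2) := by
    have h2 : Measurable (fun p : Step A × Step A => F p.1 p.2) := measurable_of_countable _
    exact h2.comp (by fun_prop : Measurable (fun p : ((i : Finset.Iic n) → Step A) × Step A =>
      (p.1 ⟨n, Finset.mem_Iic.2 le_rfl⟩, p.2)))
  exact lintegral_trajMeasure_succ (X := fun _ => Step A) _ (M.stepKernel π) n hF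

/-- Probability that step `i + 1` of an episode is made at the pair `γ`. -/
def occ (M : MDP S A) (π : Policy A) (s : S) (i : ℕ) (γ : Σ s, A s) : ℝ :=
  (M.episodeLaw π s).real {τ | τ i = some γ}

theorem occ_nonneg (M : MDP S A) (π : Policy A) (s : S) (i : ℕ) (γ : Σ s, A s) :
    0 ≤ M.occ π s i γ := measureReal_nonneg

theorem occ_le_one (M : MDP S A) (π : Policy A) (s : S) (i : ℕ) (γ : Σ s, A s) :
    M.occ π s i γ ≤ 1 := measureReal_le_one

theorem measurableSet_eval_eq (i : ℕ) (x : Step A) : MeasurableSet {τ : Traj A | τ i = x} :=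
  (measurable_pi_apply (X := fun _ : ℕ => Step A) i) (measurableSet_singleton x)

theorem episodeLaw_eval_eq (M : MDP S A) (π : Policy A) (s : S) (i : ℕ) (γ : Σ s, A s) :
    M.episodeLaw π s {τ | τ i = some γ} = ENNReal.ofReal (M.occ π s i γ) := by
  rw [occ, ofReal_measureReal]

open Classical in
theorem occ_zero (M : MDP S A) (π : Policy A) (s : S) (γ : Σ s, A s) :
    M.occ π s 0 γ = if γ.1 = s then (π 0 γ.1 γ.2).toReal else 0 := by
  have h : (M.episodeLaw π s).map (fun τ => τ 0) {some γ} = act π 0 (some s) (some γ) := by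
    rw [episodeLaw, map_eval_zero_trajMeasure (X := fun _ => Step A), PMF.toMeasure_apply_singleton _ _ (measurableSet_singleton _)]
  rw [Measure.map_apply (measurable_pi_apply 0) (measurableSet_singleton _)] at h
  rw [occ, measureReal_def]
  change (M.episodeLaw π s ((fun τ : Traj A => τ 0) ⁻¹' {some γ})).toReal = _
  rw [h, act_some_apply]
  split_ifs <;> simp

theorem lintegral_eval (M : MDP S A) (π : Policy A) (s : S) (i : ℕ) (F : Step A → ℝ≥0∞)
    (h0 : F none = 0) :
    ∫⁻ τ, F (τ i) ∂M.episodeLaw π s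
      = ∑ γ : Σ s, A s, F (some γ) * ENNReal.ofReal (M.occ π s i γ) := by
  have hm : Measurable (fun τ : Traj A => τ i) := measurable_pi_apply i
  have := lintegral_map (μ := M.episodeLaw π s) (measurable_of_countable F) hm
  rw [← this, lintegral_fintype, Fintype.sum_option, h0, zero_mul, zero_add]
  refine Finset.sum_congr rfl fun γ _ => ?_
  rw [Measure.map_apply hm (measurableSet_singleton _), ← episodeLaw_eval_eq]
  rfl

theorem lintegral_eval_ofReal (M : MDP S A) (π : Policy A) (s : S) (i : ℕ) (f : Step A → ℝ)
    (h0 : f none = 0) (hf : ∀ γ, 0 ≤ f (some γ)) :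
    ∫⁻ τ, ENNReal.ofReal (f (τ i)) ∂M.episodeLaw π s
      = ENNReal.ofReal (∑ γ : Σ s, A s, M.occ π s i γ * f (some γ)) := by
  rw [lintegral_eval M π s i (fun x => ENNReal.ofReal (f x)) (by simp [h0]),
    ENNReal.ofReal_sum_of_nonneg fun γ _ => mul_nonneg (M.occ_nonneg ..) (hf γ)]
  refine Finset.sum_congr rfl fun γ _ => ?_
  rw [ENNReal.ofReal_mul (M.occ_nonneg ..), mul_comm]

/-- The Markov identity applied to the indicator of `γ`. This is the recursion behind the `flow`
constraint, which is why occupancy probabilities and points of the polytope can be matched by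
induction on the step. -/
theorem occ_succ (M : MDP S A) (π : Policy A) (s : S) (i : ℕ) (γ : Σ s, A s) :
    M.occ π s (i + 1) γ
      = (∑ γ', M.occ π s i γ' * (M.P γ' (some γ.1)).toReal) * (π (i + 1) γ.1 γ.2).toReal := by
  classical
  have h := M.lintegral_episodeLaw_succ π s i (fun _ y => if y = some γ then 1 else 0)
  have h1 : ∀ x, ∫⁻ y, (if y = some γ then 1 else 0 : ℝ≥0∞) ∂(M.step π i x).toMeasure
      = M.step π i x (some γ) := by
    intro x
    rw [← PMF.toMeasure_apply_singleton _ _ (measurableSet_singleton _),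
      ← lintegral_indicator_one (measurableSet_singleton _)]
    refine lintegral_congr fun y => ?_
    simp [Set.indicator]
  simp only [h1] at h
  rw [lintegral_eval M π s (i + 1) (fun y => if y = some γ then 1 else 0) (by simp),
    lintegral_eval M π s i (fun x => M.step π i x (some γ)) (M.step_none_apply ..)] at h
  simp only [Option.some.injEq, ite_mul, one_mul, zero_mul, Finset.sum_ite_eq', Finset.mem_univ,
    if_true, step_some_apply] at h
  have h2 := congrArg ENNReal.toReal h
  rw [ENNReal.toReal_ofReal (M.occ_nonneg ..), ENNReal.toReal_sum] at h2
  · rw [h2, Finset.sum_mul]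
    refine Finset.sum_congr rfl fun γ' _ => ?_
    rw [ENNReal.toReal_mul, ENNReal.toReal_mul, ENNReal.toReal_ofReal (M.occ_nonneg ..)]
    ring
  · intro γ' _
    exact ENNReal.mul_ne_top (ENNReal.mul_ne_top (PMF.apply_ne_top _ _) (PMF.apply_ne_top _ _))
      ENNReal.ofReal_ne_top

/-- The probability that an episode has at least `i + 1` steps. -/
theorem measureReal_eval_ne_none (M : MDP S A) (π : Policy A) (s : S) (i : ℕ) :
    (M.episodeLaw π s).real {τ | τ i ≠ none} = ∑ γ, M.occ π s i γ := by
  classical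
  have h := M.lintegral_eval_ofReal π s i (fun x => if x = none then 0 else 1) (by simp) (by simp)
  simp only [reduceCtorEq, if_false, mul_one] at h
  have h2 : ∫⁻ τ, ENNReal.ofReal (if τ i = none then 0 else 1) ∂M.episodeLaw π s
      = M.episodeLaw π s {τ | τ i ≠ none} := by
    have hs : MeasurableSet {τ : Traj A | τ i ≠ none} := (measurableSet_eval_eq i none).compl
    rw [← lintegral_indicator_one hs]
    refine lintegral_congr fun τ => ?_
    by_cases hτ : τ i = none <;> simp [Set.indicator, hτ]
  rw [h2] at h
  rw [measureReal_def, h, ENNReal.toReal_ofReal (Finset.sum_nonneg fun γ _ => M.occ_nonneg ..)]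

theorem ae_absorbing (M : MDP S A) (π : Policy A) (s : S) (i : ℕ) :
    ∀ᵐ τ ∂M.episodeLaw π s, τ i = none → τ (i + 1) = none := by
  classical
  have h := M.lintegral_episodeLaw_succ π s i
    (fun x y => if x = none ∧ y ≠ none then 1 else 0)
  have h1 : ∀ x, ∫⁻ y, (if x = none ∧ y ≠ none then 1 else 0 : ℝ≥0∞) ∂(M.step π i x).toMeasure
      = 0 := by
    rintro (_ | γ)
    · rw [lintegral_fintype, Fintype.sum_option]
      simp only [ne_eq, not_true_eq_false, and_false, if_false, zero_mul, reduceCtorEq,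
        not_false_eq_true, and_true, if_true, one_mul, zero_add]
      refine Finset.sum_eq_zero fun γ _ => ?_
      rw [PMF.toMeasure_apply_singleton _ _ (measurableSet_singleton _), step_none_apply]
    · simp
  simp only [h1, lintegral_const, zero_mul] at h
  rw [lintegral_eq_zero_iff] at h
  · filter_upwards [h] with τ hτ h0
    by_contra h1
    simp [h0, h1] at hτ
  · exact (measurable_of_countable (fun p : Step A × Step A =>
      if p.1 = none ∧ p.2 ≠ none then (1 : ℝ≥0∞) else 0)).comp
      (by fun_prop : Measurable fun τ : Traj A => (τ i, τ (i + 1)))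

/-- The goal is reached almost surely iff the survival probability tends to zero. -/
theorem ae_reaches_iff (M : MDP S A) (π : Policy A) (s : S) :
    (∀ᵐ τ ∂M.episodeLaw π s, ∃ i, τ i = none) ↔
      Filter.Tendsto (fun i => ∑ γ, M.occ π s i γ) Filter.atTop (nhds 0) := by
  simp only [← measureReal_eval_ne_none]
  constructor
  · intro h
    have hm : ∀ i, MeasurableSet (⋂ j ∈ Set.Iic i, {τ : Traj A | τ j ≠ none}) := fun i =>
      MeasurableSet.biInter (Set.to_countable _) fun j _ => (measurableSet_eval_eq j none).compl
    -- Continuity from above requires decreasing events, so survival at all indices up to `i`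
    -- replaces survival at `i`; by absorption the two agree almost surely.
    have ht := tendsto_measure_iInter_atTop (μ := M.episodeLaw π s)
      (s := fun i => ⋂ j ∈ Set.Iic i, {τ : Traj A | τ j ≠ none})
      (fun i => (hm i).nullMeasurableSet)
      (fun i j hij => Set.biInter_subset_biInter_left (Set.Iic_subset_Iic.2 hij))
      ⟨0, measure_ne_top _ _⟩
    have h0 : M.episodeLaw π s (⋂ i : ℕ, ⋂ j ∈ Set.Iic i, {τ : Traj A | τ j ≠ none}) = 0 := by
      refine measure_mono_null ?_ h
      intro τ hτ
      simp only [Set.mem_iInter, Set.mem_ofPred_eq] at hτ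
      simp only [Set.mem_compl_iff, Set.mem_ofPred_eq, not_exists]
      exact fun i => hτ i i (Set.mem_Iic.2 le_rfl)
    rw [h0] at ht
    have h1 := (ENNReal.tendsto_toReal ENNReal.zero_ne_top).comp ht
    refine h1.congr fun i => ?_
    simp only [Function.comp, measureReal_def]
    congr 1
    refine measure_congr ((Filter.eventuallyEq_set).2 ?_)
    have hall : ∀ᵐ τ ∂M.episodeLaw π s, ∀ i, τ i = none → τ (i + 1) = none :=
      ae_all_iff.2 fun i => M.ae_absorbing π s i
    filter_upwards [hall] with τ hτ
    simp only [Set.mem_iInter, Set.mem_ofPred_eq, Set.mem_Iic]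
    refine ⟨fun h => h i le_rfl, fun h j hj hj0 => h ?_⟩
    have : ∀ d, τ (j + d) = none := by
      intro d
      induction d with
      | zero => exact hj0
      | succ d ih => exact hτ _ ih
    simpa [Nat.add_sub_cancel' hj] using this (i - j)
  · intro h
    have h0 : (M.episodeLaw π s).real {τ | ∀ i, τ i ≠ none} ≤ 0 :=
      ge_of_tendsto' h fun i => measureReal_mono (fun τ hτ => hτ i)
    have h1 : M.episodeLaw π s {τ | ∀ i, τ i ≠ none} = 0 :=
      (measureReal_eq_zero_iff).1 (le_antisymm h0 measureReal_nonneg)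
    rw [ae_iff]
    refine measure_mono_null ?_ h1
    intro τ hτ
    simpa using hτ

theorem lintegral_tsum_stepCost (M : MDP S A) (π : Policy A) (s : S) (c : (Σ s, A s) → ℝ)
    (hc : ∀ γ, 0 ≤ c γ) :
    ∫⁻ τ, ∑' i, ENNReal.ofReal (stepCost c (τ i)) ∂M.episodeLaw π s
      = ∑' i, ENNReal.ofReal (∑ γ, M.occ π s i γ * c γ) := by
  rw [lintegral_tsum]
  · refine tsum_congr fun i => ?_
    exact M.lintegral_eval_ofReal π s i (stepCost c) rfl hc
  · intro i
    exact ((measurable_of_countable (fun x : Step A => ENNReal.ofReal (stepCost c x))).comp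
      (measurable_pi_apply i)).aemeasurable

end MDP

end

section

/-! ### Online mirror descent with the log-barrier -/

/-- Only `t < 1` is compared: the far end of a segment may have vanishing active coordinates, where
the barrier is infinite. -/
theorem deriv_nonneg_of_min_on_unit {g : ℝ → ℝ} {d : ℝ} (hd : HasDerivAt g d 0)
    (hg : ∀ t, 0 < t → t < 1 → g 0 ≤ g t) : 0 ≤ d := by
  have h := hd.tendsto_slope.mono_left
    (nhdsWithin_mono 0 (fun x (hx : x ∈ Set.Ioi (0 : ℝ)) => (ne_of_gt hx : x ≠ 0)))
  refine ge_of_tendsto h ?_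
  filter_upwards [Ioo_mem_nhdsGT (zero_lt_one' ℝ)] with t ht
  rw [slope_def_field]
  exact div_nonneg (sub_nonneg.2 (hg t ht.1 ht.2)) (by linarith [ht.1])

/-- For fixed `z` the left side is largest at `x = 1 / (1 + z)`, where it equals `z - log (1 + z)`.
In a mirror descent step `x` is the ratio of new to old coordinate and `z` is `η` times the skewed
loss; no upper bound on `z` is imposed, so large importance weights are allowed. -/
theorem mul_one_sub_add_log_le {x z : ℝ} (hx : 0 < x) (hz : 0 ≤ z) :
    z * (1 - x) + (1 - x) + Real.log x ≤ z ^ 2 := by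
  have h1 : Real.log x + Real.log (1 + z) ≤ x * (1 + z) - 1 := by
    rw [← Real.log_mul hx.ne' (by positivity)]
    exact Real.log_le_sub_one_of_pos (by positivity)
  have h2 : 1 - (1 + z)⁻¹ ≤ Real.log (1 + z) := Real.one_sub_inv_le_log_of_pos (by positivity)
  have h3 : z - z ^ 2 ≤ 1 - (1 + z)⁻¹ := by
    have h4 : (1 : ℝ) - (1 + z)⁻¹ = z / (1 + z) := by field_simp; ring
    rw [h4, le_div_iff₀ (by positivity)]
    nlinarith [pow_nonneg hz 3]
  nlinarith

variable {S : Type u} {A : S → Type v}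

theorem marginal_skew (H : ℕ) (lam : ℝ) (q : Occ A) (γ : Option (Σ s, A s)) :
    marginal H (skew lam q) γ = ∑ i ∈ Finset.range H, (1 + lam * (i + 1)) * q γ i := by
  refine Finset.sum_congr rfl fun i _ => ?_
  simp only [skew]
  ring

/-- The point that divides the segment from `p` to `q` in the ratio `t : (1 - t)`. -/
def mix (t : ℝ) (p q : Occ A) : Occ A := fun γ i => (1 - t) * p γ i + t * q γ i

theorem marginal_mix (H : ℕ) (t : ℝ) (p q : Occ A) (γ : Option (Σ s, A s)) :
    marginal H (mix t p q) γ = (1 - t) * marginal H p γ + t * marginal H q γ := by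
  simp only [marginal, mix, Finset.sum_add_distrib, Finset.mul_sum]

theorem marginal_skew_mix (H : ℕ) (lam t : ℝ) (p q : Occ A) (γ : Option (Σ s, A s)) :
    marginal H (skew lam (mix t p q)) γ
      = (1 - t) * marginal H (skew lam p) γ + t * marginal H (skew lam q) γ := by
  simp only [marginal_skew, mix, Finset.mul_sum, ← Finset.sum_add_distrib]
  exact Finset.sum_congr rfl fun i _ => by ring

variable [Fintype S] [∀ s, Fintype (A s)]

theorem IsLoopFreeOcc.mix {M : MDP S A} {H₁ H₂ : ℕ} {T t : ℝ} {p q : Occ A}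
    (hp : IsLoopFreeOcc M H₁ H₂ T p) (hq : IsLoopFreeOcc M H₁ H₂ T q) (h0 : 0 ≤ t) (h1 : t ≤ 1) :
    IsLoopFreeOcc M H₁ H₂ T (mix t p q) where
  mem_unit γ i := by
    have h := (convex_Icc (0 : ℝ) 1) (hp.mem_unit γ i) (hq.mem_unit γ i) (sub_nonneg.2 h1) h0
      (by ring)
    simpa [SSP.mix] using h
  layers γ i hi := by simp [SSP.mix, hp.layers γ i hi, hq.layers γ i hi]
  total := by
    simp only [marginal_mix, Finset.sum_add_distrib, ← Finset.mul_sum]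
    nlinarith [hp.total, hq.total]
  initial := by
    simp only [SSP.mix, Finset.sum_add_distrib, ← Finset.mul_sum, hp.initial, hq.initial]
    ring
  initial_ne s a hs := by simp [SSP.mix, hp.initial_ne s a hs, hq.initial_ne s a hs]
  late γ i hi := by simp [SSP.mix, hp.late γ i hi, hq.late γ i hi]
  fast i hi := by
    simp only [SSP.mix, hp.fast i hi, hq.fast i hi]
    split_ifs
    · simp only [Finset.sum_add_distrib, ← Finset.mul_sum]
    · ring
  flow s i hi := by
    simp only [SSP.mix, Finset.sum_add_distrib, ← Finset.mul_sum, hp.flow s i hi, hq.flow s i hi]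
    simp only [Finset.mul_sum, ← Finset.sum_add_distrib]
    exact Finset.sum_congr rfl fun γ _ => by ring

variable {M : MDP S A} {H₁ H₂ : ℕ} {T : ℝ}

theorem IsLoopFreeOcc.marginal_nonneg {q : Occ A} (hq : IsLoopFreeOcc M H₁ H₂ T q)
    (γ : Option (Σ s, A s)) : 0 ≤ marginal (H₁ + H₂) q γ :=
  Finset.sum_nonneg fun i _ => (hq.mem_unit γ i).1

theorem IsLoopFreeOcc.marginal_eq_zero {q : Occ A} (hq : IsLoopFreeOcc M H₁ H₂ T q)
    {γ : Option (Σ s, A s)} (hγ : γ ∉ active M H₁ H₂ T) : marginal (H₁ + H₂) q γ = 0 := by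
  by_contra h
  exact hγ ⟨q, hq, lt_of_le_of_ne (hq.marginal_nonneg γ) (Ne.symm h)⟩

theorem IsLoopFreeOcc.eq_zero {q : Occ A} (hq : IsLoopFreeOcc M H₁ H₂ T q)
    {γ : Option (Σ s, A s)} (hγ : γ ∉ active M H₁ H₂ T) (i : ℕ) : q γ i = 0 := by
  rcases lt_or_ge i (H₁ + H₂) with hi | hi
  · exact (Finset.sum_eq_zero_iff_of_nonneg fun j _ => (hq.mem_unit γ j).1).1
      (hq.marginal_eq_zero hγ) i (Finset.mem_range.2 hi)
  · exact hq.layers γ i hi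

theorem IsLoopFreeOcc.marginal_skew_eq_zero {q : Occ A} (hq : IsLoopFreeOcc M H₁ H₂ T q)
    (lam : ℝ) {γ : Option (Σ s, A s)} (hγ : γ ∉ active M H₁ H₂ T) :
    marginal (H₁ + H₂) (skew lam q) γ = 0 := by
  rw [marginal_skew]
  exact Finset.sum_eq_zero fun i _ => by rw [hq.eq_zero hγ, mul_zero]

theorem IsLoopFreeOcc.marginal_le_skew {q : Occ A} (hq : IsLoopFreeOcc M H₁ H₂ T q)
    {lam : ℝ} (hlam : 0 ≤ lam) (γ : Option (Σ s, A s)) :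
    marginal (H₁ + H₂) q γ ≤ marginal (H₁ + H₂) (skew lam q) γ := by
  rw [marginal_skew]
  refine Finset.sum_le_sum fun i _ => ?_
  have := (hq.mem_unit γ i).1
  have : 0 ≤ lam * ((i : ℝ) + 1) * q γ i := by positivity
  linarith

theorem IsLoopFreeOcc.marginal_skew_le {q : Occ A} (hq : IsLoopFreeOcc M H₁ H₂ T q)
    {lam : ℝ} (hlam : 0 ≤ lam) (hl : lam * ((H₁ : ℝ) + H₂) ≤ 1) (γ : Option (Σ s, A s)) :
    marginal (H₁ + H₂) (skew lam q) γ ≤ 2 * marginal (H₁ + H₂) q γ := by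
  rw [marginal_skew, marginal, Finset.mul_sum]
  refine Finset.sum_le_sum fun i hi => mul_le_mul_of_nonneg_right ?_ (hq.mem_unit γ i).1
  have h1 : ((i : ℝ) + 1) ≤ (H₁ : ℝ) + H₂ := by exact_mod_cast Finset.mem_range.1 hi
  nlinarith

theorem skew_pos_of_mem {q : Occ A} (hq : q ∈ Feasible M H₁ H₂ T) {lam : ℝ} (hlam : 0 ≤ lam)
    {γ : Option (Σ s, A s)} (hγ : γ ∈ active M H₁ H₂ T) :
    0 < marginal (H₁ + H₂) (skew lam q) γ :=
  (hq.2 γ hγ).trans_le (hq.1.marginal_le_skew hlam γ)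

theorem mix_mem_Feasible {p q : Occ A} (hp : p ∈ Feasible M H₁ H₂ T)
    (hq : IsLoopFreeOcc M H₁ H₂ T q) {t : ℝ} (h0 : 0 ≤ t) (h1 : t < 1) :
    mix t p q ∈ Feasible M H₁ H₂ T := by
  refine ⟨hp.1.mix hq h0 h1.le, fun γ hγ => ?_⟩
  rw [marginal_mix]
  have := mul_pos (sub_pos.2 h1) (hp.2 γ hγ)
  have := mul_nonneg h0 (hq.marginal_nonneg γ)
  linarith

open Classical in
/-- The Bregman divergence of the log-barrier, in closed form. -/
def barrierDiv (M : MDP S A) (H₁ H₂ : ℕ) (T η : ℝ) (φ φ' : Option (Σ s, A s) → ℝ) : ℝ :=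
  1 / η * ∑ γ with γ ∈ active M H₁ H₂ T, (φ γ / φ' γ - 1 - Real.log (φ γ / φ' γ))

/-- Positivity of the active coordinates of `φ'` makes the barrier differentiable there, so that
`fderiv` is the true gradient rather than the default value. -/
theorem bregman_logBarrier (η : ℝ) {φ φ' : Option (Σ s, A s) → ℝ}
    (h : ∀ γ ∈ active M H₁ H₂ T, 0 < φ γ) (h' : ∀ γ ∈ active M H₁ H₂ T, 0 < φ' γ) :
    bregman (logBarrier M H₁ H₂ T η) φ φ' = barrierDiv M H₁ H₂ T η φ φ' := by
  classical
  have hd : HasFDerivAt (logBarrier M H₁ H₂ T η)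
      ((1 / η) • ∑ γ with γ ∈ active M H₁ H₂ T,
        -((φ' γ)⁻¹ • (ContinuousLinearMap.proj (R := ℝ) (φ := fun _ => ℝ) γ))) φ' := by
    unfold logBarrier
    refine HasFDerivAt.const_mul (HasFDerivAt.fun_sum fun γ hγ => ?_) (1 / η)
    have hγ' := h' γ (Finset.mem_filter.1 hγ).2
    have := ((hasFDerivAt_apply (𝕜 := ℝ) (F' := fun _ => ℝ) γ φ').log hγ'.ne').fun_neg
    simpa [one_div, Real.log_inv] using this
  rw [bregman, hd.fderiv]
  simp only [logBarrier, barrierDiv, smul_apply, sum_apply,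
    neg_apply, ContinuousLinearMap.proj_apply, smul_eq_mul, ← mul_sub,
    ← Finset.sum_sub_distrib]
  congr 1
  refine Finset.sum_congr rfl fun γ hγ => ?_
  have hγ' := h' γ (Finset.mem_filter.1 hγ).2
  have hγ'' := h γ (Finset.mem_filter.1 hγ).2
  rw [Real.log_div hγ''.ne' hγ'.ne', one_div, one_div, Real.log_inv, Real.log_inv, Pi.sub_apply]
  field_simp
  ring

theorem barrierDiv_nonneg {η : ℝ} (hη : 0 < η) {φ φ' : Option (Σ s, A s) → ℝ}
    (h : ∀ γ ∈ active M H₁ H₂ T, 0 < φ γ) (h' : ∀ γ ∈ active M H₁ H₂ T, 0 < φ' γ) :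
    0 ≤ barrierDiv M H₁ H₂ T η φ φ' := by
  classical
  refine mul_nonneg (by positivity) (Finset.sum_nonneg fun γ hγ => ?_)
  have hγ' := h' γ (Finset.mem_filter.1 hγ).2
  have hγ'' := h γ (Finset.mem_filter.1 hγ).2
  linarith [Real.log_le_sub_one_of_pos (div_pos hγ'' hγ')]

open Classical in
/-- The optimality condition of an update of online mirror descent. -/
theorem omd_first_order {η lam : ℝ} (hlam : 0 ≤ lam) {p q u : Occ A}
    {chat : Option (Σ s, A s) → ℝ}
    (hmin : IsMinOn (omdObjective M H₁ H₂ T η lam q chat) (Feasible M H₁ H₂ T) p)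
    (hp : p ∈ Feasible M H₁ H₂ T) (hq : q ∈ Feasible M H₁ H₂ T)
    (hu : IsLoopFreeOcc M H₁ H₂ T u) :
    0 ≤ ∑ γ, (marginal (H₁ + H₂) (skew lam u) γ - marginal (H₁ + H₂) (skew lam p) γ) * chat γ
      + 1 / η * ∑ γ with γ ∈ active M H₁ H₂ T,
        (marginal (H₁ + H₂) (skew lam u) γ - marginal (H₁ + H₂) (skew lam p) γ)
          * (1 / marginal (H₁ + H₂) (skew lam q) γ - 1 / marginal (H₁ + H₂) (skew lam p) γ) := by
  set Φ := fun p : Occ A => marginal (H₁ + H₂) (skew lam p) with hΦ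
  have hΦγ : ∀ p γ, marginal (H₁ + H₂) (skew lam p) γ = Φ p γ := fun _ _ => rfl
  simp only [hΦγ]
  have hpos : ∀ r ∈ Feasible M H₁ H₂ T, ∀ γ ∈ active M H₁ H₂ T, 0 < Φ r γ :=
    fun r hr γ hγ => skew_pos_of_mem hr hlam hγ
  -- The objective along the segment from `p` to `u`, written so that its derivative at `0` is
  -- explicit; it agrees with the objective only for `0 ≤ t < 1`.
  let g : ℝ → ℝ := fun t => ∑ γ, (Φ p γ + t * (Φ u γ - Φ p γ)) * chat γ
    + 1 / η * ∑ γ with γ ∈ active M H₁ H₂ T, ((Φ p γ + t * (Φ u γ - Φ p γ)) / Φ q γ - 1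
      - Real.log ((Φ p γ + t * (Φ u γ - Φ p γ)) / Φ q γ))
  have hg : ∀ t, 0 ≤ t → t < 1 → omdObjective M H₁ H₂ T η lam q chat (mix t p u) = g t := by
    intro t h0 h1
    have hm := mix_mem_Feasible hp hu h0 h1
    have hval : ∀ γ, Φ (mix t p u) γ = Φ p γ + t * (Φ u γ - Φ p γ) := by
      intro γ
      simp only [hΦ, marginal_skew_mix]
      ring
    rw [omdObjective, bregman_logBarrier η (hpos _ hm) (hpos _ hq), barrierDiv]
    simp only [hΦγ, hval, g]
  have hp0 : mix 0 p u = p := by ext γ i; simp [mix]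
  refine deriv_nonneg_of_min_on_unit (g := g) ?_ ?_
  · refine HasDerivAt.add (HasDerivAt.fun_sum fun γ _ => ?_)
      (HasDerivAt.const_mul _ (HasDerivAt.fun_sum fun γ hγ => ?_))
    · have h := (((hasDerivAt_id (0 : ℝ)).mul_const (Φ u γ - Φ p γ)).const_add (Φ p γ)).mul_const
        (chat γ)
      simpa using h
    · have hγ' := (Finset.mem_filter.1 hγ).2
      have h := (((hasDerivAt_id (0 : ℝ)).mul_const (Φ u γ - Φ p γ)).const_add (Φ p γ)).div_const
        (Φ q γ)
      have hp' := hpos p hp γ hγ'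
      have hq' := hpos q hq γ hγ'
      have hne : (Φ p γ + id (0 : ℝ) * (Φ u γ - Φ p γ)) / Φ q γ ≠ 0 := by
        simp only [id, zero_mul, add_zero]
        positivity
      refine ((h.sub_const 1).fun_sub (h.log hne)).congr_deriv ?_
      simp only [id, zero_mul, add_zero, one_mul]
      field_simp
  · intro t h0 h1
    rw [← hg t h0.le h1, ← hg 0 le_rfl zero_lt_one, hp0]
    exact hmin (mix_mem_Feasible hp hu h0.le h1)

/-- One step of online mirror descent with the log-barrier. -/
theorem omd_step {η lam : ℝ} (hη : 0 < η) (hlam : 0 ≤ lam) {p q u : Occ A}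
    {chat : Option (Σ s, A s) → ℝ} (hchat : ∀ γ, 0 ≤ chat γ)
    (hmin : IsMinOn (omdObjective M H₁ H₂ T η lam q chat) (Feasible M H₁ H₂ T) p)
    (hp : p ∈ Feasible M H₁ H₂ T) (hq : q ∈ Feasible M H₁ H₂ T)
    (hu : u ∈ Feasible M H₁ H₂ T) :
    ∑ γ, (marginal (H₁ + H₂) (skew lam q) γ - marginal (H₁ + H₂) (skew lam u) γ) * chat γ
      - η * ∑ γ, (marginal (H₁ + H₂) (skew lam q) γ * chat γ) ^ 2
      ≤ barrierDiv M H₁ H₂ T η (marginal (H₁ + H₂) (skew lam u)) (marginal (H₁ + H₂) (skew lam q))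
        - barrierDiv M H₁ H₂ T η (marginal (H₁ + H₂) (skew lam u))
          (marginal (H₁ + H₂) (skew lam p)) := by
  classical
  have h := omd_first_order hlam hmin hp hq hu.1
  have hz : ∀ r ∈ Feasible M H₁ H₂ T, ∀ γ, γ ∉ active M H₁ H₂ T →
      marginal (H₁ + H₂) (skew lam r) γ = 0 := fun r hr γ hγ => hr.1.marginal_skew_eq_zero lam hγ
  have hpos : ∀ r ∈ Feasible M H₁ H₂ T, ∀ γ ∈ active M H₁ H₂ T,
      0 < marginal (H₁ + H₂) (skew lam r) γ := fun r hr γ hγ => skew_pos_of_mem hr hlam hγ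
  have hres : ∀ f : Option (Σ s, A s) → ℝ, (∀ γ, γ ∉ active M H₁ H₂ T → f γ = 0) →
      ∑ γ, f γ = ∑ γ with γ ∈ active M H₁ H₂ T, f γ := by
    intro f hf
    refine (Finset.sum_subset (Finset.filter_subset _ _) fun γ _ hγ => hf γ fun h => hγ ?_).symm
    exact Finset.mem_filter.2 ⟨Finset.mem_univ _, h⟩
  rw [hres _ (fun γ hγ => by rw [hz u hu γ hγ, hz p hp γ hγ]; ring)] at h
  rw [hres _ (fun γ hγ => by rw [hz u hu γ hγ, hz q hq γ hγ]; ring),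
    hres _ (fun γ hγ => by rw [hz q hq γ hγ]; ring)]
  simp only [barrierDiv]
  rw [← mul_sub, ← Finset.sum_sub_distrib, Finset.mul_sum, Finset.mul_sum, ← Finset.sum_sub_distrib]
  rw [Finset.mul_sum, ← Finset.sum_add_distrib] at h
  rw [← add_zero (∑ γ with γ ∈ active M H₁ H₂ T, _)]
  refine (add_le_add le_rfl h).trans ?_
  rw [← Finset.sum_add_distrib]
  refine Finset.sum_le_sum fun γ hγ => ?_
  have hγ' := (Finset.mem_filter.1 hγ).2
  have hp' := hpos p hp γ hγ'
  have hq' := hpos q hq γ hγ'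
  have hu' := hpos u hu γ hγ'
  have hc := hchat γ
  -- The claim now splits over coordinates: `P` is the new point, `Q` the old one, `U` the
  -- comparator and `x` the estimated cost. The terms in `U` cancel against the optimality
  -- condition, leaving the scalar inequality in `P / Q`.
  generalize marginal (H₁ + H₂) (skew lam p) γ = P at *
  generalize marginal (H₁ + H₂) (skew lam q) γ = Q at *
  generalize marginal (H₁ + H₂) (skew lam u) γ = U at *
  generalize chat γ = x at *
  have key := mul_one_sub_add_log_le (x := P / Q) (z := η * (Q * x)) (by positivity) (by positivity)
  have key2 := mul_le_mul_of_nonneg_left key (by positivity : 0 ≤ 1 / η)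
  rw [Real.log_div hp'.ne' hq'.ne'] at key2
  rw [Real.log_div hu'.ne' hq'.ne', Real.log_div hu'.ne' hp'.ne']
  have e1 : 1 / η * (η * (Q * x)) ^ 2 = η * (Q * x) ^ 2 := by field_simp
  have e2 : 1 / η * (η * (Q * x) * (1 - P / Q) + (1 - P / Q) + (Real.log P - Real.log Q))
      = (Q - P) * x + 1 / η * ((1 - P / Q) + (Real.log P - Real.log Q)) := by
    field_simp
    ring
  rw [e1, e2] at key2
  have e3 : (U - P) * (1 / Q - 1 / P) = U / Q - U / P - P / Q + 1 := by field_simp; ring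
  rw [e3]
  linarith

/-- The initial divergence of online mirror descent. -/
theorem barrierDiv_init_le {η lam : ℝ} (hη : 0 < η) (hlam : 0 ≤ lam) {q₁ u : Occ A}
    (hmin : IsMinOn (fun p => logBarrier M H₁ H₂ T η (marginal (H₁ + H₂) (skew lam p)))
      (Feasible M H₁ H₂ T) q₁)
    (hq : q₁ ∈ Feasible M H₁ H₂ T) (hu : u ∈ Feasible M H₁ H₂ T) {ε : ℝ} (hε : 0 < ε) (hε1 : ε ≤ 1)
    (hle : ∀ γ, ε * marginal (H₁ + H₂) (skew lam q₁) γ ≤ marginal (H₁ + H₂) (skew lam u) γ) :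
    barrierDiv M H₁ H₂ T η (marginal (H₁ + H₂) (skew lam u)) (marginal (H₁ + H₂) (skew lam q₁))
      ≤ (Fintype.card (Σ s, A s) + 1) / η * Real.log (1 / ε) := by
  classical
  set Φ := fun p : Occ A => marginal (H₁ + H₂) (skew lam p) with hΦ
  have hΦγ : ∀ p γ, marginal (H₁ + H₂) (skew lam p) γ = Φ p γ := fun _ _ => rfl
  have hΦ' : ∀ p, marginal (H₁ + H₂) (skew lam p) = Φ p := fun _ => rfl
  simp only [hΦγ, hΦ'] at hle hmin ⊢
  have hpos : ∀ r ∈ Feasible M H₁ H₂ T, ∀ γ ∈ active M H₁ H₂ T, 0 < Φ r γ :=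
    fun r hr γ hγ => skew_pos_of_mem hr hlam hγ
  -- First-order optimality of `q₁`: the barrier does not decrease towards `u`. Hence the linear
  -- term of the divergence can be dropped, and only a difference of barrier values remains.
  have h1 : 0 ≤ 1 / η * ∑ γ with γ ∈ active M H₁ H₂ T, -((Φ u γ - Φ q₁ γ) / Φ q₁ γ) := by
    refine deriv_nonneg_of_min_on_unit (g := fun t => logBarrier M H₁ H₂ T η
      (fun γ => Φ q₁ γ + t * (Φ u γ - Φ q₁ γ))) ?_ ?_
    · unfold logBarrier
      refine HasDerivAt.const_mul _ (HasDerivAt.fun_sum fun γ hγ => ?_)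
      have hq' := hpos q₁ hq γ (Finset.mem_filter.1 hγ).2
      have h := (((hasDerivAt_id (0 : ℝ)).mul_const (Φ u γ - Φ q₁ γ)).const_add (Φ q₁ γ))
      have h2 := (h.log (by simpa using hq'.ne')).fun_neg
      simpa [one_div, Real.log_inv] using h2
    · intro t h0 h1
      have hm := hmin (mix_mem_Feasible hq hu.1 h0.le h1)
      simp only [Set.mem_ofPred_eq] at hm
      have e : Φ (mix t q₁ u) = fun γ => Φ q₁ γ + t * (Φ u γ - Φ q₁ γ) := by
        ext γ
        simp only [hΦ, marginal_skew_mix]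
        ring
      simpa [e] using hm
  have hlog : 0 ≤ Real.log (1 / ε) := Real.log_nonneg (by rw [le_div_iff₀ hε]; linarith)
  have h2 : barrierDiv M H₁ H₂ T η (Φ u) (Φ q₁)
      ≤ 1 / η * ∑ γ with γ ∈ active M H₁ H₂ T, Real.log (1 / ε) := by
    refine (le_add_of_nonneg_right h1).trans ?_
    rw [barrierDiv, ← mul_add, ← Finset.sum_add_distrib]
    refine mul_le_mul_of_nonneg_left (Finset.sum_le_sum fun γ hγ => ?_) (by positivity)
    have hq' := hpos q₁ hq γ (Finset.mem_filter.1 hγ).2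
    have hu' := hpos u hu γ (Finset.mem_filter.1 hγ).2
    have e : Φ u γ / Φ q₁ γ - 1 - Real.log (Φ u γ / Φ q₁ γ) + -((Φ u γ - Φ q₁ γ) / Φ q₁ γ)
        = Real.log (Φ q₁ γ / Φ u γ) := by
      rw [← inv_div (Φ u γ), Real.log_inv]
      field_simp
      ring
    rw [e]
    refine Real.log_le_log (by positivity) ?_
    rw [div_le_div_iff₀ hu' hε]
    linarith [hle γ]
  refine h2.trans ?_
  rw [Finset.sum_const, nsmul_eq_mul, ← mul_assoc, div_eq_mul_one_div (_ + 1), mul_comm (1 / η)]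
  refine mul_le_mul_of_nonneg_right (mul_le_mul_of_nonneg_right ?_ (by positivity)) hlog
  -- The additional `1` in the bound is the coordinate of the fast state.
  have : (Finset.univ.filter fun γ => γ ∈ active M H₁ H₂ T).card
      ≤ Fintype.card (Option (Σ s, A s)) := Finset.card_le_univ _
  rw [Fintype.card_option] at this
  exact_mod_cast this

end

section

/-! ### Stationary deterministic policies -/

theorem sum_toReal_eq_one {α : Type*} [Fintype α] (p : PMF α) : ∑ x, (p x).toReal = 1 := by
  rw [← ENNReal.toReal_sum fun _ _ => PMF.apply_ne_top _ _, ← tsum_fintype (L := .unconditional _),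
    PMF.tsum_coe, ENNReal.toReal_one]

variable {S : Type u} {A : S → Type v} [Fintype S]

namespace MDP

theorem sum_P_le_one (M : MDP S A) (γ : Σ s, A s) : ∑ s', (M.P γ (some s')).toReal ≤ 1 := by
  have h := sum_toReal_eq_one (M.P γ)
  rw [Fintype.sum_option] at h
  linarith [ENNReal.toReal_nonneg (a := M.P γ none)]

/-- The expected value, after one step of the policy `f`, of a function that vanishes at the goal. -/
def next (M : MDP S A) (f : (s : S) → A s) : (S → ℝ) →ₗ[ℝ] (S → ℝ) where
  toFun v s := ∑ s', (M.P ⟨s, f s⟩ (some s')).toReal * v s'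
  map_add' v w := by ext s; simp [mul_add, Finset.sum_add_distrib]
  map_smul' r v := by ext s; simp [Finset.mul_sum, mul_left_comm]

variable (M : MDP S A) (f : (s : S) → A s)

theorem next_apply (v : S → ℝ) (s : S) :
    M.next f v s = ∑ s', (M.P ⟨s, f s⟩ (some s')).toReal * v s' := rfl

theorem next_mono {v w : S → ℝ} (h : v ≤ w) : M.next f v ≤ M.next f w := fun _ =>
  Finset.sum_le_sum fun s' _ => mul_le_mul_of_nonneg_left (h s') ENNReal.toReal_nonneg

theorem next_pow_mono (n : ℕ) {v w : S → ℝ} (h : v ≤ w) : (M.next f ^ n) v ≤ (M.next f ^ n) w := by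
  induction n with
  | zero => simpa using h
  | succ n ih =>
    rw [pow_succ', Module.End.mul_apply, Module.End.mul_apply]
    exact M.next_mono f ih

theorem next_pow_nonneg (n : ℕ) {v : S → ℝ} (h : 0 ≤ v) : 0 ≤ (M.next f ^ n) v := by
  simpa using M.next_pow_mono f n h

theorem next_one_le : M.next f 1 ≤ 1 := fun s => by
  simpa [next_apply] using M.sum_P_le_one ⟨s, f s⟩

theorem next_pow_one_antitone : Antitone fun n => (M.next f ^ n) 1 := by
  refine antitone_nat_of_succ_le fun n => ?_
  rw [pow_succ, Module.End.mul_apply]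
  exact M.next_pow_mono f n (M.next_one_le f)

theorem next_pow_le_of_le {v : S → ℝ} {B : ℝ} (h : ∀ s, v s ≤ B) (n : ℕ) (s : S) :
    (M.next f ^ n) v s ≤ B * (M.next f ^ n) 1 s := by
  have h1 : v ≤ B • (1 : S → ℝ) := fun s => by simpa using h s
  simpa using M.next_pow_mono f n h1 s

/-- The value of the policy `f` for the state costs `w`. -/
def value (w : S → ℝ) (s : S) : ℝ := ∑' n, (M.next f ^ n) w s

variable {M f}

theorem next_pow_mul_le {L : ℕ} {r : ℝ} (hr : 0 ≤ r) (h : ∀ s, (M.next f ^ L) 1 s ≤ r) (n : ℕ)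
    (s : S) : (M.next f ^ (L * n)) 1 s ≤ r ^ n := by
  induction n generalizing s with
  | zero => simp
  | succ n ih =>
    rw [mul_add, mul_one, add_comm, pow_add, Module.End.mul_apply, pow_succ]
    refine (M.next_pow_le_of_le f ih L s).trans ?_
    exact mul_le_mul_of_nonneg_left (h s) (pow_nonneg hr n)

/-- Unroll the inequality `n` times, using that `next` is monotone. With `w = 0` it says that an
excessive function bounds all its iterates. -/
theorem sum_add_pow_le {w V : S → ℝ} (h : w + M.next f V ≤ V) (n : ℕ) :
    ∑ i ∈ Finset.range n, (M.next f ^ i) w + (M.next f ^ n) V ≤ V := by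
  induction n with
  | zero => simp
  | succ n ih =>
    refine le_trans ?_ ih
    rw [Finset.sum_range_succ, add_assoc, pow_succ, Module.End.mul_apply, ← map_add]
    exact add_le_add le_rfl (M.next_pow_mono f n h)

theorem le_sum_add_pow {w V : S → ℝ} (h : V ≤ w + M.next f V) (n : ℕ) :
    V ≤ ∑ i ∈ Finset.range n, (M.next f ^ i) w + (M.next f ^ n) V := by
  induction n with
  | zero => simp
  | succ n ih =>
    refine ih.trans ?_
    rw [Finset.sum_range_succ, add_assoc, pow_succ, Module.End.mul_apply, ← map_add]
    exact add_le_add le_rfl (M.next_pow_mono f n h)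

theorem value_nonneg {w : S → ℝ} (hw : 0 ≤ w) (s : S) : 0 ≤ M.value f w s :=
  tsum_nonneg fun n => M.next_pow_nonneg f n hw s

theorem value_smul (r : ℝ) (w : S → ℝ) (s : S) : M.value f (r • w) s = r * M.value f w s := by
  simp only [value, map_smul, Pi.smul_apply, smul_eq_mul, tsum_mul_left]

variable [∀ s, Fintype (A s)]

variable (M f)

theorem sum_occ_mul_zero (π : Policy A) (s : S) (w : S → ℝ) :
    ∑ γ, M.occ π s 0 γ * w γ.1 = w s := by
  classical
  simp only [occ_zero]
  rw [← Finset.univ_sigma_univ, Finset.sum_sigma, Finset.sum_eq_single s]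
  · simp only [if_true, ← Finset.sum_mul]
    rw [sum_toReal_eq_one, one_mul]
  · intro s' _ hs'
    simp [hs']
  · simp

theorem sum_occ_mul_succ (π : Policy A) (s : S) (i : ℕ) (w : S → ℝ) :
    ∑ γ, M.occ π s (i + 1) γ * w γ.1
      = ∑ γ, M.occ π s i γ * ∑ s', (M.P γ (some s')).toReal * w s' := by
  simp only [occ_succ]
  have h : ∀ s' : S, ∑ a, (∑ γ', M.occ π s i γ' * (M.P γ' (some s')).toReal)
      * (π (i + 1) s' a).toReal * w s'
      = (∑ γ', M.occ π s i γ' * (M.P γ' (some s')).toReal) * w s' := by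
    intro s'
    rw [← Finset.sum_mul, ← Finset.mul_sum, sum_toReal_eq_one, mul_one]
  refine ((Fintype.sum_sigma _).trans (Finset.sum_congr rfl fun s' _ => h s')).trans ?_
  simp only [Finset.sum_mul, Finset.mul_sum]
  rw [Finset.sum_comm]
  exact Finset.sum_congr rfl fun γ _ => Finset.sum_congr rfl fun s' _ => by ring

theorem occ_eq_zero_of_det {π : Policy A} {i : ℕ} (h : ∀ s, π i s = PMF.pure (f s)) (s : S)
    (γ : Σ s, A s) (hγ : γ.2 ≠ f γ.1) : M.occ π s i γ = 0 := by
  classical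
  have h0 : (π i γ.1 γ.2).toReal = 0 := by rw [h, PMF.pure_apply, if_neg hγ]; rfl
  cases i with
  | zero => rw [occ_zero]; split_ifs <;> simp [h0]
  | succ i => rw [occ_succ, h0, mul_zero]

theorem sum_occ_det {π : Policy A} {i : ℕ} (h : ∀ s, π i s = PMF.pure (f s)) (s : S)
    (c : (Σ s, A s) → ℝ) :
    ∑ γ, M.occ π s i γ * c γ = ∑ γ, M.occ π s i γ * c ⟨γ.1, f γ.1⟩ := by
  refine Finset.sum_congr rfl fun γ _ => ?_
  by_cases hγ : γ.2 = f γ.1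
  · rw [← hγ]
  · rw [M.occ_eq_zero_of_det f h s γ hγ, zero_mul, zero_mul]

/-- The Markov property at step `m`, after which the policy is `f`. It serves with `m = 0` for
stationary policies and with `m = H₁` for the tail of the learner's policy. -/
theorem sum_occ_add {π : Policy A} {m : ℕ} (h : ∀ i, m ≤ i → ∀ s, π i s = PMF.pure (f s)) (s : S)
    (n : ℕ) (w : S → ℝ) :
    ∑ γ, M.occ π s (m + n) γ * w γ.1 = ∑ γ, M.occ π s m γ * (M.next f ^ n) w γ.1 := by
  induction n generalizing w with
  | zero => simp
  | succ n ih =>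
    rw [← add_assoc, sum_occ_mul_succ,
      M.sum_occ_det f (h _ (by omega)) s (fun γ => ∑ s', (M.P γ (some s')).toReal * w s')]
    rw [pow_succ, Module.End.mul_apply, ← ih]
    rfl

theorem sum_occ_detPolicy (s : S) (n : ℕ) (c : (Σ s, A s) → ℝ) :
    ∑ γ, M.occ (detPolicy f) s n γ * c γ = (M.next f ^ n) (fun s => c ⟨s, f s⟩) s := by
  rw [M.sum_occ_det f (fun _ => rfl)]
  have h := M.sum_occ_add f (π := detPolicy f) (m := 0) (fun _ _ _ => rfl) s n (fun s => c ⟨s, f s⟩)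
  rw [zero_add] at h
  rw [h, sum_occ_mul_zero]

theorem proper_iff :
    M.Proper f ↔ ∀ s, Filter.Tendsto (fun n => (M.next f ^ n) 1 s) Filter.atTop (nhds 0) := by
  refine forall_congr' fun s => ?_
  rw [ae_reaches_iff]
  have h : ∀ n, ∑ γ, M.occ (detPolicy f) s n γ = (M.next f ^ n) 1 s := fun n => by
    have := M.sum_occ_detPolicy f s n (fun _ => 1)
    simp only [mul_one] at this
    exact this
  simp only [h]

theorem costToGo_eq_tsum {c : (Σ s, A s) → ℝ} (hc : ∀ γ, 0 ≤ c γ) (s : S) :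
    M.costToGo c f s = ∑' n, ENNReal.ofReal ((M.next f ^ n) (fun s => c ⟨s, f s⟩) s) := by
  rw [costToGo, lintegral_tsum_stepCost _ _ _ _ hc]
  simp only [sum_occ_detPolicy]

variable {M f}

theorem Proper.exists_le_half (hf : M.Proper f) : ∃ L, ∀ s, (M.next f ^ L) 1 s ≤ 1 / 2 := by
  have h : ∀ᶠ L in Filter.atTop, ∀ s, (M.next f ^ L) 1 s ≤ 1 / 2 := by
    rw [Filter.eventually_all]
    intro s
    exact ((M.proper_iff f).1 hf s).eventually (eventually_le_nhds (by norm_num))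
  exact h.exists

theorem Proper.summable_one (hf : M.Proper f) (s : S) : Summable fun n => (M.next f ^ n) 1 s := by
  obtain ⟨L, hL⟩ := hf.exists_le_half
  have hn : ∀ n s, 0 ≤ (M.next f ^ n) 1 s := fun n s => M.next_pow_nonneg f n zero_le_one s
  have h1 : ∀ n s, (M.next f ^ n) 1 s ≤ 1 := fun n s => by
    simpa using M.next_pow_one_antitone f (Nat.zero_le n) s
  refine summable_of_sum_range_le (c := 2 * L) (fun n => hn n s) fun N => ?_
  let W : S → ℝ := ∑ n ∈ Finset.range N, (M.next f ^ n) 1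
  have hW : ∀ s, W s = ∑ n ∈ Finset.range N, (M.next f ^ n) 1 s := fun s => by
    simp [W, Finset.sum_apply]
  obtain ⟨s', -, hs'⟩ := Finset.exists_max_image Finset.univ W ⟨s, Finset.mem_univ s⟩
  rw [← hW]
  refine (hs' s (Finset.mem_univ s)).trans ?_
  -- At a maximizing state, the first `L` terms contribute at most `L` and the others at most half
  -- the maximum, since survival after `L` steps is at most `1 / 2`. So the maximum is at most `2 *
  -- L`.
  have h2 : W s' ≤ L + (M.next f ^ L) W s' := by
    have e : (M.next f ^ L) W s' = ∑ n ∈ Finset.range N, (M.next f ^ (L + n)) 1 s' := by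
      simp only [W, map_sum, Finset.sum_apply, pow_add, Module.End.mul_apply]
    rw [e, hW]
    have h3 : ∑ n ∈ Finset.range N, (M.next f ^ n) 1 s'
        ≤ ∑ n ∈ Finset.range (L + N), (M.next f ^ n) 1 s' :=
      Finset.sum_le_sum_of_subset_of_nonneg (Finset.range_mono (by omega)) fun n _ _ => hn n s'
    rw [Finset.sum_range_add] at h3
    refine h3.trans (add_le_add ?_ le_rfl)
    simpa using Finset.sum_le_card_nsmul (Finset.range L) _ 1 fun n _ => h1 n s'
  have h3 := M.next_pow_le_of_le f (fun s => hs' s (Finset.mem_univ s)) L s'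
  have h0 : 0 ≤ W s' := by rw [hW]; exact Finset.sum_nonneg fun n _ => hn n s'
  nlinarith [hL s']

theorem Proper.summable (hf : M.Proper f) (w : S → ℝ) (s : S) :
    Summable fun n => (M.next f ^ n) w s := by
  obtain ⟨B, hB⟩ : ∃ B, ∀ s, |w s| ≤ B :=
    ⟨∑ s, |w s|, fun s => Finset.single_le_sum (f := fun s => |w s|) (fun _ _ => abs_nonneg _)
      (Finset.mem_univ s)⟩
  refine Summable.of_norm_bounded ((hf.summable_one s).mul_left B) fun n => ?_
  rw [Real.norm_eq_abs, abs_le]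
  have h1 := M.next_pow_le_of_le f (fun s => (le_abs_self _).trans (hB s)) n s
  have h2 := M.next_pow_le_of_le f (v := -w) (fun s => (neg_le_abs _).trans (hB s)) n s
  rw [map_neg, Pi.neg_apply] at h2
  exact ⟨by linarith, h1⟩

theorem Proper.costToGo_eq (hf : M.Proper f) {c : (Σ s, A s) → ℝ} (hc : ∀ γ, 0 ≤ c γ) (s : S) :
    M.costToGo c f s = ENNReal.ofReal (M.value f (fun s => c ⟨s, f s⟩) s) := by
  rw [costToGo_eq_tsum _ _ hc, value, ENNReal.ofReal_tsum_of_nonneg _ (hf.summable _ s)]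
  exact fun n => M.next_pow_nonneg f n (fun s => hc _) s

theorem Proper.toReal_costToGo (hf : M.Proper f) {c : (Σ s, A s) → ℝ} (hc : ∀ γ, 0 ≤ c γ) (s : S) :
    (M.costToGo c f s).toReal = M.value f (fun s => c ⟨s, f s⟩) s := by
  rw [hf.costToGo_eq hc, ENNReal.toReal_ofReal (value_nonneg (fun s => hc _) s)]

theorem Proper.sum_le_value (hf : M.Proper f) {w : S → ℝ} (hw : 0 ≤ w) (n : ℕ) (s : S) :
    ∑ i ∈ Finset.range n, (M.next f ^ i) w s ≤ M.value f w s :=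
  (hf.summable w s).sum_le_tsum _ fun i _ => M.next_pow_nonneg f i hw s

theorem Proper.value_eq (hf : M.Proper f) (w : S → ℝ) :
    M.value f w = w + M.next f (M.value f w) := by
  ext s
  rw [value, (hf.summable w s).tsum_eq_zero_add, Pi.add_apply, next_apply]
  simp only [pow_zero, Module.End.one_apply, pow_succ', Module.End.mul_apply, next_apply, value]
  congr 1
  rw [Summable.tsum_finsetSum fun s' _ => (hf.summable w s').mul_left _]
  simp only [tsum_mul_left]

theorem Proper.value_add (hf : M.Proper f) (w w' : S → ℝ) (s : S) :
    M.value f (w + w') s = M.value f w s + M.value f w' s := by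
  simp only [value, map_add, Pi.add_apply]
  exact (hf.summable w s).tsum_add (hf.summable w' s)

theorem Proper.value_sum (hf : M.Proper f) {ι : Type*} (t : Finset ι) (w : ι → S → ℝ) (s : S) :
    M.value f (∑ k ∈ t, w k) s = ∑ k ∈ t, M.value f (w k) s := by
  simp only [value, map_sum, Finset.sum_apply]
  exact Summable.tsum_finsetSum fun k _ => hf.summable (w k) s

theorem Proper.value_mono (hf : M.Proper f) {w w' : S → ℝ} (h : w ≤ w') (s : S) :
    M.value f w s ≤ M.value f w' s :=
  (hf.summable w s).tsum_le_tsum (fun n => M.next_pow_mono f n h s) (hf.summable w' s)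

theorem Proper.tendsto_zero (hf : M.Proper f) (w : S → ℝ) (s : S) :
    Filter.Tendsto (fun n => (M.next f ^ n) w s) Filter.atTop (nhds 0) :=
  (hf.summable w s).tendsto_atTop_zero

/-- A supersolution of the evaluation equation with costs at least `1` certifies properness and bounds
the value. -/
theorem proper_of_supersolution {w V : S → ℝ} (hw : 1 ≤ w) (hV : 0 ≤ V)
    (h : w + M.next f V ≤ V) : M.Proper f ∧ ∀ s, M.value f w s ≤ V s := by
  have hw0 : 0 ≤ w := zero_le_one.trans hw
  have hpart : ∀ n s, ∑ i ∈ Finset.range n, (M.next f ^ i) w s ≤ V s := by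
    intro n s
    have h1 := sum_add_pow_le h n s
    have h2 := M.next_pow_nonneg f n hV s
    simp only [Pi.add_apply, Finset.sum_apply, Pi.zero_apply] at h1 h2
    linarith
  have hs : ∀ s, Summable fun n => (M.next f ^ n) w s := fun s =>
    summable_of_sum_range_le (fun n => M.next_pow_nonneg f n hw0 s) fun n => hpart n s
  refine ⟨(M.proper_iff f).2 fun s => ?_, fun s => ?_⟩
  · exact squeeze_zero (fun n => M.next_pow_nonneg f n zero_le_one s)
      (fun n => M.next_pow_mono f n hw s) (hs s).tendsto_atTop_zero
  · exact (hs s).tsum_le_of_sum_range_le fun n => hpart n s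

/-- Iterating leaves the remainder `next ^ n V`, which tends to `0` because the policy is proper. -/
theorem Proper.le_value_of_subsolution (hf : M.Proper f) {w V : S → ℝ}
    (h : V ≤ w + M.next f V) (s : S) : V s ≤ M.value f w s := by
  have h1 : Filter.Tendsto (fun n => ∑ i ∈ Finset.range n, (M.next f ^ i) w s + (M.next f ^ n) V s)
      Filter.atTop (nhds (M.value f w s + 0)) :=
    (hf.summable w s).hasSum.tendsto_sum_nat.add (hf.tendsto_zero V s)
  rw [add_zero] at h1
  refine ge_of_tendsto' h1 fun n => ?_
  simpa using le_sum_add_pow h n s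

variable (M) in
/-- For costs that are at least `1`, some proper policy has a value function that satisfies the Bellman
optimality inequality. -/
theorem exists_optimal (hex : ∃ f, M.Proper f) {c : (Σ s, A s) → ℝ} (hc : ∀ γ, 1 ≤ c γ) :
    ∃ g, M.Proper g ∧ ∀ γ : Σ s, A s, M.value g (fun s => c ⟨s, g s⟩) γ.1
      ≤ c γ + ∑ s', (M.P γ (some s')).toReal * M.value g (fun s => c ⟨s, g s⟩) s' := by
  classical
  obtain ⟨f₀, hf₀⟩ := hex
  -- Minimizing the sum over all start states turns a strict improvement at one state, with no loss
  -- elsewhere, into a contradiction.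
  obtain ⟨g, hg, hmin⟩ := Set.exists_min_image {f | M.Proper f}
    (fun f => ∑ s, M.value f (fun s => c ⟨s, f s⟩) s) (Set.toFinite _) ⟨f₀, hf₀⟩
  refine ⟨g, hg, fun γ => ?_⟩
  obtain ⟨s, a⟩ := γ
  by_contra! hlt
  set V := M.value g (fun s => c ⟨s, g s⟩) with hV
  have hVeq : V = (fun s => c ⟨s, g s⟩) + M.next g V := hg.value_eq _
  have hV0 : 0 ≤ V := fun s => value_nonneg (fun s => zero_le_one.trans (hc _)) s
  let g' := Function.update g s a
  have hs : g' s = a := Function.update_self ..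
  -- Where the Bellman inequality fails, switching to `a` keeps `V` a supersolution. As the costs
  -- are at least `1`, this also shows that the modified policy is proper.
  have hsup : (fun s => c ⟨s, g' s⟩) + M.next g' V ≤ V := by
    intro s'
    by_cases h : s' = s
    · subst h
      simp only [Pi.add_apply, next_apply, hs]
      exact hlt.le
    · have h' : g' s' = g s' := Function.update_of_ne h ..
      simp only [Pi.add_apply, next_apply, h']
      exact (congrFun hVeq s').ge
  obtain ⟨hp, hle⟩ := proper_of_supersolution (fun s => hc _) hV0 hsup
  have hlt' : M.value g' (fun s => c ⟨s, g' s⟩) s < V s := by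
    rw [hp.value_eq]
    refine lt_of_le_of_lt ?_ hlt
    simp only [Pi.add_apply, hs]
    refine add_le_add le_rfl ?_
    have h1 := M.next_mono g' (v := M.value g' (fun s => c ⟨s, g' s⟩)) (w := V) hle s
    rw [next_apply, next_apply, hs] at h1
    rw [next_apply, hs]
    exact h1
  have := hmin g' hp
  exact absurd this (not_le.2 (Finset.sum_lt_sum (fun s _ => hle s) ⟨s, Finset.mem_univ s, hlt'⟩))

theorem Proper.hittingTime_eq (hf : M.Proper f) (s : S) :
    M.hittingTime f s = ENNReal.ofReal (M.value f 1 s) :=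
  hf.costToGo_eq (fun _ => zero_le_one) s

theorem Proper.toReal_hittingTime (hf : M.Proper f) (s : S) :
    (M.hittingTime f s).toReal = M.value f 1 s :=
  hf.toReal_costToGo (fun _ => zero_le_one) s

theorem Proper.one_le_value (hf : M.Proper f) (s : S) : 1 ≤ M.value f 1 s := by
  simpa using hf.sum_le_value (w := 1) zero_le_one 1 s

theorem IsFast.value_le_diameter (hf : M.IsFast f) (s : S) :
    M.value f 1 s ≤ M.diameter.toReal := by
  -- Finiteness matters because `toReal` sends `∞` to `0`.
  have h1 : M.diameter ≠ ∞ := by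
    refine ne_top_of_le_ne_top (b := ⨆ s, M.hittingTime f s) ?_
      (iSup_mono fun s => iInf_le_of_le ⟨f, hf.1⟩ le_rfl)
    rw [← lt_top_iff_ne_top]
    have : Nonempty S := ⟨s⟩
    obtain ⟨s', hs'⟩ := Finite.exists_max (M.hittingTime f)
    refine (iSup_le hs').trans_lt ?_
    rw [hf.1.hittingTime_eq]
    exact ENNReal.ofReal_lt_top
  rw [← hf.1.toReal_hittingTime]
  refine ENNReal.toReal_mono h1 ?_
  refine le_trans ?_ (le_iSup (fun s => ⨅ g : {g : (s : S) → A s // M.Proper g}, M.hittingTime g.1 s) s)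
  exact le_iInf fun g => hf.2 g.1 g.2 s

/-- Exponential decay of the survival probability. -/
theorem Proper.next_pow_one_le (hf : M.Proper f) {K H : ℕ} (hK : 2 ≤ K) (hH : 0 < H)
    (h : ∀ s, 8 * M.value f 1 s * Real.log K ≤ H) (s : S) :
    (M.next f ^ (H - 1)) 1 s ≤ 2 / (K : ℝ) ^ 2 := by
  have hK0 : (0 : ℝ) < K := by positivity
  obtain ⟨m, -, hm⟩ := Finset.exists_max_image Finset.univ (M.value f 1) ⟨s, Finset.mem_univ s⟩
  set t := M.value f 1 m with ht
  have ht1 : 1 ≤ t := hf.one_le_value m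
  -- Markov's inequality: by monotonicity `(L + 1)` times the survival probability at `L` is at most
  -- the expected time `t`, and `L + 1 > 2 * t`. Survival is therefore halved every `L` steps.
  set L := ⌊2 * t⌋₊ with hL
  have hLt : (L : ℝ) ≤ 2 * t := Nat.floor_le (by linarith)
  have hLt' : 2 * t < L + 1 := Nat.lt_floor_add_one _
  have hL0 : 0 < L := Nat.floor_pos.2 (by linarith)
  have hhalf : ∀ s, (M.next f ^ L) 1 s ≤ 1 / 2 := by
    intro s
    have h1 : ∑ i ∈ Finset.range (L + 1), (M.next f ^ L) 1 s
        ≤ ∑ i ∈ Finset.range (L + 1), (M.next f ^ i) 1 s :=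
      Finset.sum_le_sum fun i hi =>
        M.next_pow_one_antitone f (Nat.lt_succ_iff.1 (Finset.mem_range.1 hi)) s
    rw [Finset.sum_const, Finset.card_range, nsmul_eq_mul] at h1
    push_cast at h1
    have h2 := hf.sum_le_value (w := 1) zero_le_one (L + 1) s
    have h3 := hm s (Finset.mem_univ s)
    by_contra! h4
    have h5 : ((L : ℝ) + 1) * (1 / 2) < ((L : ℝ) + 1) * (M.next f ^ L) 1 s :=
      mul_lt_mul_of_pos_left h4 (by positivity)
    linarith
  set n := (H - 1) / L with hn
  have h1 : (M.next f ^ (H - 1)) 1 s ≤ (1 / 2) ^ n :=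
    (M.next_pow_one_antitone f (Nat.mul_div_le (H - 1) L) s).trans
      (next_pow_mul_le (by norm_num) hhalf n s)
  refine h1.trans ?_
  have h2 : (H : ℝ) ≤ L * (n + 1) := by
    have : H - 1 < L * (n + 1) := Nat.lt_mul_div_succ (H - 1) hL0
    have h3 : H ≤ L * (n + 1) := by omega
    exact_mod_cast h3
  have hlog : 0 ≤ Real.log K := Real.log_nonneg (by exact_mod_cast (by omega : 1 ≤ K))
  have h3 : 4 * Real.log K ≤ n + 1 := by
    have h4 : 8 * t * Real.log K ≤ 2 * t * (n + 1) :=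
      (h m).trans (h2.trans (mul_le_mul_of_nonneg_right hLt (by positivity)))
    have h5 : 2 * t * (4 * Real.log K) ≤ 2 * t * (n + 1) := by linarith
    exact le_of_mul_le_mul_left h5 (by linarith)
  -- From `n + 1 ≥ 4 * log K` and `log 2 > 1 / 2`. The floor in `n` costs one halving, hence the
  -- numerator `2` in the bound.
  have h4 : (K : ℝ) ^ 2 ≤ 2 ^ (n + 1) := by
    rw [← Real.log_le_log_iff (by positivity) (by positivity), Real.log_pow, Real.log_pow]
    push_cast
    have h6 := Real.log_two_gt_d9
    nlinarith
  rw [pow_succ] at h4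
  rw [one_div, inv_pow, le_div_iff₀ (by positivity), inv_mul_le_iff₀ (by positivity)]
  rwa [pow_succ]

/-- Summation by parts: a cost paid at index `i < n` occurs in the cost-to-go at each of the `i + 1`
indices `0, …, i`. -/
theorem Proper.sum_pow_value (hf : M.Proper f) (w : S → ℝ) (n : ℕ) (s : S) :
    ∑ i ∈ Finset.range n, (M.next f ^ i) (M.value f w) s
      = ∑ i ∈ Finset.range n, ((i : ℝ) + 1) * (M.next f ^ i) w s
        + n * (M.next f ^ n) (M.value f w) s := by
  induction n with
  | zero => simp
  | succ n ih =>
    rw [Finset.sum_range_succ, Finset.sum_range_succ, ih]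
    have h : (M.next f ^ n) (M.value f w) s
        = (M.next f ^ n) w s + (M.next f ^ (n + 1)) (M.value f w) s := by
      conv_lhs => rw [hf.value_eq w]
      rw [map_add, pow_succ, Module.End.mul_apply, Pi.add_apply]
    push_cast
    linear_combination (1 + (n : ℝ)) * h

/-- The costs of the best policy, weighted with the time at which they are paid. -/
theorem IsBest.sum_weighted_le {c : ℕ → (Σ s, A s) → ℝ} {K : ℕ}
    (hc : ∀ k γ, c k γ ∈ Set.Icc (0 : ℝ) 1) (hf : M.IsBest c K f) {g : (s : S) → A s}
    (hg : M.IsFast g) (n : ℕ) :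
    ∑ i ∈ Finset.range n, ((i : ℝ) + 1)
        * (M.next f ^ i) (fun s => ∑ k ∈ Finset.range K, c k ⟨s, f s⟩) M.s₀
      ≤ ((K + 1) * M.diameter.toReal + n) * M.value f 1 M.s₀ := by
  have hp := hf.1
  -- The summand `1` rules out free loops, so that an optimal proper policy for `b` exists; it is
  -- added once, not once per episode, and therefore changes values only by a hitting time.
  set b : (Σ s, A s) → ℝ := fun γ => 1 + ∑ k ∈ Finset.range K, c k γ with hb
  have hb1 : ∀ γ, 1 ≤ b γ := fun γ => by
    have : 0 ≤ ∑ k ∈ Finset.range K, c k γ := Finset.sum_nonneg fun k _ => (hc k γ).1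
    simp only [hb]
    linarith
  have hbK : ∀ γ, b γ ≤ K + 1 := fun γ => by
    have : ∑ k ∈ Finset.range K, c k γ ≤ K := by
      simpa using Finset.sum_le_card_nsmul (Finset.range K) _ 1 fun k _ => (hc k γ).2
    simp only [hb]
    linarith
  have hdec : ∀ h, M.Proper h → M.value h (fun s => b ⟨s, h s⟩) M.s₀
      = M.value h 1 M.s₀ + ∑ k ∈ Finset.range K, (M.costToGo (c k) h M.s₀).toReal := by
    intro h hh
    have e : (fun s => b ⟨s, h s⟩) = 1 + ∑ k ∈ Finset.range K, fun s => c k ⟨s, h s⟩ := by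
      ext s
      simp [hb]
    rw [e, hh.value_add, hh.value_sum]
    congr 1
    exact Finset.sum_congr rfl fun k _ => (hh.toReal_costToGo (fun γ => (hc k γ).1) _).symm
  obtain ⟨h, hh, hopt⟩ := M.exists_optimal ⟨f, hp⟩ hb1
  set W := M.value h (fun s => b ⟨s, h s⟩) with hW
  set V := M.value f (fun s => b ⟨s, f s⟩) with hV
  have hWV : ∀ s, W s ≤ V s := hp.le_value_of_subsolution fun s => hopt ⟨s, f s⟩
  -- The optimal value is compared with the fast policy, which pays at most `K + 1` per step.
  have hWg : ∀ s, W s ≤ (K + 1) * M.diameter.toReal := fun s => by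
    have h1 : W s ≤ M.value g (fun s => b ⟨s, g s⟩) s :=
      hg.1.le_value_of_subsolution (fun s => hopt ⟨s, g s⟩) s
    have h2 : M.value g (fun s => b ⟨s, g s⟩) s ≤ M.value g (((K : ℝ) + 1) • 1) s :=
      hg.1.value_mono (fun s => by simpa using hbK _) s
    rw [value_smul] at h2
    exact h1.trans (h2.trans (mul_le_mul_of_nonneg_left (hg.value_le_diameter s) (by positivity)))
  -- On the true costs `f` is no worse than `h` from `s₀`; only the perturbation can be to its
  -- disadvantage, and that costs `f` its hitting time.
  have hδ : V M.s₀ - W M.s₀ ≤ M.value f 1 M.s₀ := by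
    have h1 := hf.2 h hh
    have hfin : ∀ h', M.Proper h' → ∀ k ∈ Finset.range K, M.costToGo (c k) h' M.s₀ ≠ ∞ := by
      intro h' hh' k _
      rw [hh'.costToGo_eq fun γ => (hc k γ).1]
      exact ENNReal.ofReal_ne_top
    have h2 := ENNReal.toReal_mono (ENNReal.sum_ne_top.2 (hfin h hh)) h1
    rw [ENNReal.toReal_sum (hfin h hh), ENNReal.toReal_sum (hfin f hp)] at h2
    rw [hV, hW, hdec f hp, hdec h hh]
    linarith [hh.one_le_value M.s₀]
  -- `V` satisfies the evaluation equation of `f` and `W` is a subsolution of it. So the excess over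
  -- optimality does not grow in expectation along `f`, although it may be large at single states.
  have hsuper : M.next f (V - W) ≤ V - W := by
    intro s
    have h1 := congrFun (hp.value_eq (fun s => b ⟨s, f s⟩)) s
    have h2 : W s ≤ b ⟨s, f s⟩ + M.next f W s := hopt ⟨s, f s⟩
    simp only [map_sub, Pi.sub_apply, Pi.add_apply] at h1 ⊢
    rw [← hV] at h1
    linarith
  have hsuper' : ∀ i, (M.next f ^ i) (V - W) ≤ V - W := fun i => by
    simpa using sum_add_pow_le (w := 0) (V := V - W) (by rwa [zero_add]) i
  have key := hp.sum_pow_value (fun s => b ⟨s, f s⟩) n M.s₀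
  rw [← hV] at key
  have hV0 : 0 ≤ V := fun s => value_nonneg (fun s => zero_le_one.trans (hb1 _)) s
  have hlast : 0 ≤ (n : ℝ) * (M.next f ^ n) V M.s₀ :=
    mul_nonneg (Nat.cast_nonneg n) (M.next_pow_nonneg f n hV0 M.s₀)
  have hup : ∑ i ∈ Finset.range n, (M.next f ^ i) V M.s₀
      ≤ (K + 1) * M.diameter.toReal * M.value f 1 M.s₀ + n * M.value f 1 M.s₀ := by
    have hstep : ∀ i ∈ Finset.range n, (M.next f ^ i) V M.s₀
        ≤ (K + 1) * M.diameter.toReal * (M.next f ^ i) 1 M.s₀ + M.value f 1 M.s₀ := by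
      intro i _
      have h1 := M.next_pow_le_of_le f hWg i M.s₀
      have h2 := hsuper' i M.s₀
      simp only [map_sub, Pi.sub_apply] at h2
      linarith
    refine (Finset.sum_le_sum hstep).trans ?_
    rw [Finset.sum_add_distrib, ← Finset.mul_sum, Finset.sum_const, Finset.card_range, nsmul_eq_mul]
    have := hp.sum_le_value (w := 1) zero_le_one n M.s₀
    have hD : 0 ≤ ((K : ℝ) + 1) * M.diameter.toReal := by positivity
    nlinarith
  have hlow : ∑ i ∈ Finset.range n, ((i : ℝ) + 1)
        * (M.next f ^ i) (fun s => ∑ k ∈ Finset.range K, c k ⟨s, f s⟩) M.s₀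
      ≤ ∑ i ∈ Finset.range n, ((i : ℝ) + 1) * (M.next f ^ i) (fun s => b ⟨s, f s⟩) M.s₀ := by
    refine Finset.sum_le_sum fun i _ => mul_le_mul_of_nonneg_left ?_ (by positivity)
    refine M.next_pow_mono f i (fun s => ?_) M.s₀
    simp [hb]
  linarith

end MDP

end

section

/-! ### One episode of the learner -/

theorem sum_sub_mul_eq (a b l : ℝ) (n : ℕ → ℝ) (H : ℕ) :
    ∑ i ∈ Finset.range H, (a - b * (i + 1) * l) * n i
      = a * ∑ i ∈ Finset.range H, n i - l * (b * ∑ i ∈ Finset.range H, ((i : ℝ) + 1) * n i) := by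
  rw [Finset.mul_sum, Finset.mul_sum, Finset.mul_sum, ← Finset.sum_sub_distrib]
  exact Finset.sum_congr rfl fun i _ => by ring

/-- In expanding the square, a visit at index `i` is paired with at most `i` earlier visits. This
bounds a second moment by a quantity linear in the visits. -/
theorem sq_sum_le {n : ℕ → ℝ} (hn : ∀ i, n i ∈ Set.Icc (0 : ℝ) 1) (H : ℕ) :
    (∑ i ∈ Finset.range H, n i) ^ 2 ≤ 2 * ∑ i ∈ Finset.range H, ((i : ℝ) + 1) * n i := by
  induction H with
  | zero => simp
  | succ H ih =>
    have h1 : ∑ i ∈ Finset.range H, n i ≤ H := by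
      simpa using Finset.sum_le_card_nsmul (Finset.range H) _ 1 fun i _ => (hn i).2
    rw [Finset.sum_range_succ, Finset.sum_range_succ]
    nlinarith [(hn H).1, (hn H).2]

variable {S : Type u} {A : S → Type v} {H₁ H₂ : ℕ}

theorem loopFreeCost_mem {c : (Σ s, A s) → ℝ} (hc : ∀ γ, c γ ∈ Set.Icc (0 : ℝ) 1)
    (γ : Option (Σ s, A s)) : loopFreeCost c γ ∈ Set.Icc (0 : ℝ) 1 := by
  cases γ with
  | none => simp [loopFreeCost]
  | some γ => exact hc γ

theorem stepCost_nonneg {c : (Σ s, A s) → ℝ} (hc : ∀ γ, 0 ≤ c γ) (x : Step A) :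
    0 ≤ stepCost c x := by
  cases x with
  | none => exact le_rfl
  | some γ => exact hc γ

theorem tsum_stepCost_eq {c : (Σ s, A s) → ℝ} (hc : ∀ γ, 0 ≤ c γ) (τ : Traj A) :
    ∑' i, stepCost c (τ i) = (∑' i, ENNReal.ofReal (stepCost c (τ i))).toReal := by
  rw [ENNReal.tsum_toReal_eq fun _ => ENNReal.ofReal_ne_top]
  exact tsum_congr fun i => (ENNReal.toReal_ofReal (stepCost_nonneg hc _)).symm

theorem visits_mem (τ : Traj A) (γ : Option (Σ s, A s)) (i : ℕ) :
    visits H₁ H₂ τ γ i ∈ Set.Icc (0 : ℝ) 1 := by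
  cases γ <;> simp only [visits] <;> split_ifs <;> simp

variable [∀ s, Fintype (A s)] {πf : (s : S) → A s} {q : Occ A}

/-- If `q` has no mass at `s` in this step, both sides vanish, so the default action there has no
effect. -/
theorem sum_mul_execPolicy (hq : ∀ γ i, 0 ≤ q γ i) {i : ℕ} (hi : i < H₁) (s : S) (a : A s) :
    (∑ a, q (some ⟨s, a⟩) i) * (execPolicy H₁ πf q i s a).toReal = q (some ⟨s, a⟩) i := by
  have hsum : ∑' a, ENNReal.ofReal (q (some ⟨s, a⟩) i)
      = ENNReal.ofReal (∑ a, q (some ⟨s, a⟩) i) := by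
    rw [tsum_fintype, ENNReal.ofReal_sum_of_nonneg fun _ _ => hq _ _]
  rcases (Finset.sum_nonneg fun a (_ : a ∈ Finset.univ) => hq (some ⟨s, a⟩) i).eq_or_lt with h0 | h0
  · rw [← h0, zero_mul]
    exact ((Finset.sum_eq_zero_iff_of_nonneg fun a _ => hq _ _).1 h0.symm a (Finset.mem_univ a)).symm
  · have h : i < H₁ ∧ ∑' a, ENNReal.ofReal (q (some ⟨s, a⟩) i) ≠ 0 := by
      refine ⟨hi, ?_⟩
      rw [hsum]
      exact (ENNReal.ofReal_pos.2 h0).ne'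
    rw [execPolicy, dif_pos h, PMF.normalize_apply, hsum, ENNReal.toReal_mul, ENNReal.toReal_inv,
      ENNReal.toReal_ofReal (hq _ _), ENNReal.toReal_ofReal h0.le]
    field_simp

theorem execPolicy_of_le {i : ℕ} (hi : H₁ ≤ i) (s : S) :
    execPolicy H₁ πf q i s = PMF.pure (πf s) := by
  rw [execPolicy, dif_neg fun h => absurd h.1 (not_lt.2 hi)]

variable [Fintype S] {M : MDP S A} {T : ℝ}

theorem IsLoopFreeOcc.occ_execPolicy (hq : IsLoopFreeOcc M H₁ H₂ T q) {i : ℕ} (hi : i < H₁)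
    (γ : Σ s, A s) : M.occ (execPolicy H₁ πf q) M.s₀ i γ = q (some γ) i := by
  have h0 : ∀ γ i, 0 ≤ q γ i := fun γ i => (hq.mem_unit γ i).1
  induction i generalizing γ with
  | zero =>
    obtain ⟨s, a⟩ := γ
    rw [MDP.occ_zero]
    split_ifs with h
    · change s = M.s₀ at h
      subst h
      have := sum_mul_execPolicy (πf := πf) h0 hi M.s₀ a
      rwa [hq.initial, one_mul] at this
    · exact (hq.initial_ne s a h).symm
  | succ i ih =>
    rw [MDP.occ_succ, ← sum_mul_execPolicy (πf := πf) h0 hi γ.1 γ.2, hq.flow γ.1 i hi]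
    congr 1
    refine Finset.sum_congr rfl fun γ' _ => ?_
    rw [ih (by omega), mul_comm]

theorem IsLoopFreeOcc.marginal_none (hq : IsLoopFreeOcc M H₁ H₂ T q) :
    marginal (H₁ + H₂) q none = H₂ * ∑ γ, q (some γ) (H₁ - 1) := by
  rw [marginal, Finset.sum_congr rfl fun i hi => hq.fast i (Finset.mem_range.1 hi),
    Finset.sum_range_add, Finset.sum_eq_zero, zero_add]
  · rw [Finset.sum_congr rfl fun i _ => if_pos (Nat.le_add_right H₁ i), Finset.sum_const,
      Finset.card_range, nsmul_eq_mul]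
  · exact fun i hi => if_neg (not_le.2 (Finset.mem_range.1 hi))

theorem IsLoopFreeOcc.marginal_some (hq : IsLoopFreeOcc M H₁ H₂ T q) (γ : Σ s, A s) :
    marginal (H₁ + H₂) q (some γ) = ∑ i ∈ Finset.range H₁, q (some γ) i := by
  rw [marginal, Finset.sum_range_add, add_eq_left]
  exact Finset.sum_eq_zero fun i _ => hq.late γ _ (Nat.le_add_right H₁ i)

theorem MDP.sum_occ_succ_le (M : MDP S A) (π : Policy A) (s : S) (i : ℕ) :
    ∑ γ, M.occ π s (i + 1) γ ≤ ∑ γ, M.occ π s i γ := by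
  have h := M.sum_occ_mul_succ π s i 1
  simp only [Pi.one_apply, mul_one] at h
  rw [h]
  exact Finset.sum_le_sum fun γ _ =>
    mul_le_of_le_one_right (M.occ_nonneg π s i γ) (M.sum_P_le_one γ)

/-- The first `H₁` steps reproduce the loop-free costs exactly. The tail is executed by the fast
policy, whose expected time from any state is at most `D ≤ H₂`, the charge of the fast state per
unit of mass. -/
theorem sum_cost_execPolicy_le (hH : 0 < H₁) (hf : M.IsFast πf) (hD : M.diameter.toReal ≤ H₂)
    {c : (Σ s, A s) → ℝ} (hc : ∀ γ, c γ ∈ Set.Icc (0 : ℝ) 1) (hq : IsLoopFreeOcc M H₁ H₂ T q)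
    (n : ℕ) :
    ∑ i ∈ Finset.range n, ∑ γ, M.occ (execPolicy H₁ πf q) M.s₀ i γ * c γ
      ≤ ∑ γ, marginal (H₁ + H₂) q γ * loopFreeCost c γ := by
  set π := execPolicy H₁ πf q with hπ
  have ho : ∀ i γ, 0 ≤ M.occ π M.s₀ i γ := M.occ_nonneg π M.s₀
  have h1 : ∑ i ∈ Finset.range n, ∑ γ, M.occ π M.s₀ i γ * c γ
      ≤ ∑ i ∈ Finset.range (H₁ + n), ∑ γ, M.occ π M.s₀ i γ * c γ :=
    Finset.sum_le_sum_of_subset_of_nonneg (Finset.range_mono (by omega)) fun i _ _ =>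
      Finset.sum_nonneg fun γ _ => mul_nonneg (ho i γ) (hc γ).1
  refine h1.trans ?_
  rw [Finset.sum_range_add, Fintype.sum_option, add_comm]
  refine add_le_add ?_ ?_
  · rw [hq.marginal_none, loopFreeCost, mul_one]
    have h2 : ∀ j ∈ Finset.range n, ∑ γ, M.occ π M.s₀ (H₁ + j) γ * c γ
        ≤ ∑ γ, M.occ π M.s₀ H₁ γ * (M.next πf ^ j) 1 γ.1 := by
      intro j _
      rw [← M.sum_occ_add πf (π := π) (m := H₁) (fun i hi s => execPolicy_of_le hi s) M.s₀ j 1]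
      exact Finset.sum_le_sum fun γ _ => mul_le_mul_of_nonneg_left (hc γ).2 (ho _ γ)
    refine (Finset.sum_le_sum h2).trans ?_
    rw [Finset.sum_comm]
    simp only [← Finset.mul_sum]
    have h3 : ∀ γ ∈ Finset.univ, M.occ π M.s₀ H₁ γ
        * ∑ j ∈ Finset.range n, (M.next πf ^ j) 1 γ.1 ≤ M.occ π M.s₀ H₁ γ * H₂ := fun γ _ =>
      mul_le_mul_of_nonneg_left ((hf.1.sum_le_value zero_le_one n γ.1).trans
        ((hf.value_le_diameter γ.1).trans hD)) (ho _ γ)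
    refine (Finset.sum_le_sum h3).trans ?_
    rw [← Finset.sum_mul, mul_comm]
    refine mul_le_mul_of_nonneg_left ?_ (Nat.cast_nonneg _)
    -- The fast state is charged for the mass at index `H₁ - 1`, whereas the fast policy starts at
    -- index `H₁`; survival only decreases in between.
    have h4 := M.sum_occ_succ_le π M.s₀ (H₁ - 1)
    rw [Nat.sub_add_cancel hH] at h4
    refine h4.trans (le_of_eq (Finset.sum_congr rfl fun γ _ => ?_))
    exact hq.occ_execPolicy (by omega) γ
  · rw [Finset.sum_comm]
    refine le_of_eq (Finset.sum_congr rfl fun γ _ => ?_)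
    rw [hq.marginal_some, Finset.sum_mul]
    exact Finset.sum_congr rfl fun i hi => by
      rw [hq.occ_execPolicy (Finset.mem_range.1 hi)]; rfl

theorem lintegral_cost_execPolicy_le (hH : 0 < H₁) (hf : M.IsFast πf)
    (hD : M.diameter.toReal ≤ H₂) {c : (Σ s, A s) → ℝ} (hc : ∀ γ, c γ ∈ Set.Icc (0 : ℝ) 1)
    (hq : IsLoopFreeOcc M H₁ H₂ T q) :
    ∫⁻ τ, ∑' i, ENNReal.ofReal (stepCost c (τ i)) ∂M.episodeLaw (execPolicy H₁ πf q) M.s₀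
      ≤ ENNReal.ofReal (∑ γ, marginal (H₁ + H₂) q γ * loopFreeCost c γ) := by
  rw [M.lintegral_tsum_stepCost _ _ _ fun γ => (hc γ).1]
  refine ENNReal.tsum_le_of_sum_range_le fun n => ?_
  rw [← ENNReal.ofReal_sum_of_nonneg]
  · exact ENNReal.ofReal_le_ofReal (sum_cost_execPolicy_le hH hf hD hc hq n)
  · exact fun i _ => Finset.sum_nonneg fun γ _ => mul_nonneg (M.occ_nonneg ..) (hc γ).1

theorem ae_reaches_execPolicy (hH : 0 < H₁) (hf : M.IsFast πf)
    (hD : M.diameter.toReal ≤ H₂) (hq : IsLoopFreeOcc M H₁ H₂ T q) :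
    ∀ᵐ τ ∂M.episodeLaw (execPolicy H₁ πf q) M.s₀, ∃ i, τ i = none := by
  rw [MDP.ae_reaches_iff]
  -- With unit costs the bound says that the survival probabilities are summable, so they tend to
  -- zero.
  have h := sum_cost_execPolicy_le hH hf hD (c := fun _ => 1) (fun _ => by simp) hq
  simp only [mul_one] at h
  exact (summable_of_sum_range_le (fun i => Finset.sum_nonneg fun γ _ => M.occ_nonneg ..)
    h).tendsto_atTop_zero

theorem measurable_tsum_ofReal_stepCost (c : (Σ s, A s) → ℝ) :
    Measurable fun τ : Traj A => ∑' i, ENNReal.ofReal (stepCost c (τ i)) :=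
  Measurable.tsum fun i =>
    (measurable_of_countable (fun x : Step A => ENNReal.ofReal (stepCost c x))).comp
      (measurable_pi_apply i)

theorem measurable_tsum_stepCost {c : (Σ s, A s) → ℝ} (hc : ∀ γ, 0 ≤ c γ) :
    Measurable fun τ : Traj A => ∑' i, stepCost c (τ i) := by
  simp only [tsum_stepCost_eq hc]
  exact (measurable_tsum_ofReal_stepCost c).ennreal_toReal

open Classical in
theorem measurable_visits (γ : Option (Σ s, A s)) (i : ℕ) :
    Measurable fun τ : Traj A => visits H₁ H₂ τ γ i := by
  cases γ with
  | none =>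
    exact (measurable_of_countable (fun x : Step A =>
      if H₁ ≤ i ∧ i < H₁ + H₂ ∧ x ≠ none then (1 : ℝ) else 0)).comp (measurable_pi_apply (H₁ - 1))
  | some γ =>
    exact (measurable_of_countable (fun x : Step A =>
      if i < H₁ ∧ x = some γ then (1 : ℝ) else 0)).comp (measurable_pi_apply i)

theorem integrable_visits (π : Policy A) (γ : Option (Σ s, A s)) (i : ℕ) :
    Integrable (fun τ => visits H₁ H₂ τ γ i) (M.episodeLaw π M.s₀) :=
  Integrable.of_bound (measurable_visits γ i).aestronglyMeasurable 1 <| .of_forall fun τ => by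
    rw [Real.norm_eq_abs, abs_of_nonneg (visits_mem τ γ i).1]
    exact (visits_mem τ γ i).2

theorem integral_visits (hH : 0 < H₁) (hq : IsLoopFreeOcc M H₁ H₂ T q) (γ : Option (Σ s, A s))
    {i : ℕ} (hi : i < H₁ + H₂) :
    ∫ τ, visits H₁ H₂ τ γ i ∂M.episodeLaw (execPolicy H₁ πf q) M.s₀ = q γ i := by
  have hind : ∀ s : Set (Traj A), MeasurableSet s → ∀ f : Traj A → ℝ,
      (∀ τ, f τ = s.indicator 1 τ) → ∫ τ, f τ ∂M.episodeLaw (execPolicy H₁ πf q) M.s₀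
        = (M.episodeLaw (execPolicy H₁ πf q) M.s₀).real s := by
    intro s hs f hf
    simp only [hf, integral_indicator_one hs]
  cases γ with
  | none =>
    rw [hq.fast i hi]
    split_ifs with h
    · rw [hind {τ | τ (H₁ - 1) ≠ none} (MDP.measurableSet_eval_eq _ none).compl,
        MDP.measureReal_eval_ne_none]
      · exact Finset.sum_congr rfl fun γ _ => hq.occ_execPolicy (by omega) γ
      · intro τ
        by_cases hτ : τ (H₁ - 1) = none <;> simp [visits, h, hi, hτ, Set.indicator]
    · simp [visits, h]
  | some γ =>
    by_cases h : i < H₁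
    · rw [hind {τ | τ i = some γ} (MDP.measurableSet_eval_eq _ _)]
      · exact hq.occ_execPolicy h γ
      · intro τ
        by_cases hτ : τ i = some γ <;> simp [visits, h, hτ, Set.indicator]
    · rw [hq.late γ i (not_lt.1 h)]
      simp [visits, h]

theorem integral_sum_visits (hH : 0 < H₁) (hq : IsLoopFreeOcc M H₁ H₂ T q)
    (a : Option (Σ s, A s) → ℕ → ℝ) :
    ∫ τ, ∑ γ, ∑ i ∈ Finset.range (H₁ + H₂), a γ i * visits H₁ H₂ τ γ i
        ∂M.episodeLaw (execPolicy H₁ πf q) M.s₀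
      = ∑ γ, ∑ i ∈ Finset.range (H₁ + H₂), a γ i * q γ i := by
  rw [integral_finsetSum _ fun γ _ => integrable_finsetSum _ fun i _ =>
    (integrable_visits _ γ i).const_mul _]
  refine Finset.sum_congr rfl fun γ _ => ?_
  rw [integral_finsetSum _ fun i _ => (integrable_visits _ γ i).const_mul _]
  refine Finset.sum_congr rfl fun i hi => ?_
  rw [integral_const_mul, integral_visits hH hq γ (Finset.mem_range.1 hi)]

/-- The left-hand side of the guarantee of one step of online mirror descent against `u`, after an
episode with point `q` and trajectory `τ`. -/
def omdGain (H₁ H₂ : ℕ) (η lam : ℝ) (u : Occ A) (c : (Σ s, A s) → ℝ) (q : Occ A) (τ : Traj A) : ℝ :=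
  ∑ γ, (marginal (H₁ + H₂) (skew lam q) γ - marginal (H₁ + H₂) (skew lam u) γ)
      * estimator H₁ H₂ c q τ γ
    - η * ∑ γ, (marginal (H₁ + H₂) (skew lam q) γ * estimator H₁ H₂ c q τ γ) ^ 2

theorem measurable_estimator (c : (Σ s, A s) → ℝ) (γ : Option (Σ s, A s)) :
    Measurable fun τ => estimator H₁ H₂ c q τ γ :=
  ((Finset.measurable_fun_sum _ fun i _ => measurable_visits γ i).mul_const _).div_const _

theorem measurable_omdGain (η lam : ℝ) (u : Occ A) (c : (Σ s, A s) → ℝ) :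
    Measurable fun τ => omdGain H₁ H₂ η lam u c q τ :=
  (Finset.measurable_fun_sum _ fun γ _ => (measurable_estimator c γ).const_mul _).sub
    ((Finset.measurable_fun_sum _ fun γ _ =>
      ((measurable_estimator c γ).const_mul _).pow_const 2).const_mul _)

theorem estimator_nonneg {c : (Σ s, A s) → ℝ} (hc : ∀ γ, c γ ∈ Set.Icc (0 : ℝ) 1)
    (hq : IsLoopFreeOcc M H₁ H₂ T q) (τ : Traj A) (γ : Option (Σ s, A s)) :
    0 ≤ estimator H₁ H₂ c q τ γ :=
  div_nonneg (mul_nonneg (Finset.sum_nonneg fun i _ => (visits_mem τ γ i).1)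
    (loopFreeCost_mem hc γ).1) (hq.marginal_nonneg γ)

/-- Since `φ_q ≤ 2 q`, a squared term is at most `4 N² c² ≤ 8 c` times the sum of the visit times,
and `8 * η = lam`. The resulting pathwise lower bound is linear in the visits, so its expectation is
available from `integral_visits`. -/
theorem omdGain_ge {η lam : ℝ} (hη : 0 < η) (hlam : lam = 8 * η) (hl : lam * ((H₁ : ℝ) + H₂) ≤ 1)
    (u : Occ A) {c : (Σ s, A s) → ℝ} (hc : ∀ γ, c γ ∈ Set.Icc (0 : ℝ) 1)
    (hq : IsLoopFreeOcc M H₁ H₂ T q) (τ : Traj A) :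
    ∑ γ, ∑ i ∈ Finset.range (H₁ + H₂),
      ((marginal (H₁ + H₂) (skew lam q) γ - marginal (H₁ + H₂) (skew lam u) γ)
          * (loopFreeCost c γ / marginal (H₁ + H₂) q γ) - lam * (i + 1) * loopFreeCost c γ)
        * visits H₁ H₂ τ γ i ≤ omdGain H₁ H₂ η lam u c q τ := by
  have hlam0 : 0 ≤ lam := by linarith
  rw [omdGain, Finset.mul_sum, ← Finset.sum_sub_distrib]
  refine Finset.sum_le_sum fun γ _ => ?_
  obtain ⟨hl0, hl1⟩ := loopFreeCost_mem hc γ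
  have hm := hq.marginal_nonneg γ
  have hN : marginal (H₁ + H₂) (visits H₁ H₂ τ) γ
      = ∑ i ∈ Finset.range (H₁ + H₂), visits H₁ H₂ τ γ i := rfl
  have hN0 : 0 ≤ marginal (H₁ + H₂) (visits H₁ H₂ τ) γ :=
    Finset.sum_nonneg fun i _ => (visits_mem τ γ i).1
  have h1 : marginal (H₁ + H₂) (skew lam q) γ * estimator H₁ H₂ c q τ γ
      ≤ 2 * (marginal (H₁ + H₂) (visits H₁ H₂ τ) γ * loopFreeCost c γ) := by
    refine (mul_le_mul_of_nonneg_right (hq.marginal_skew_le hlam0 hl γ)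
      (estimator_nonneg hc hq τ γ)).trans ?_
    rw [mul_assoc, estimator]
    refine mul_le_mul_of_nonneg_left ?_ zero_le_two
    -- If the pair has no mass under `q`, the left side vanishes.
    rcases hm.eq_or_lt with h0 | h0
    · rw [← h0, zero_mul]
      positivity
    · rw [mul_div_cancel₀ _ h0.ne']
  have h1' : 0 ≤ marginal (H₁ + H₂) (skew lam q) γ * estimator H₁ H₂ c q τ γ :=
    mul_nonneg (hm.trans (hq.marginal_le_skew hlam0 γ)) (estimator_nonneg hc hq τ γ)
  have h2 : (marginal (H₁ + H₂) (skew lam q) γ * estimator H₁ H₂ c q τ γ) ^ 2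
      ≤ 8 * ((∑ i ∈ Finset.range (H₁ + H₂), ((i : ℝ) + 1) * visits H₁ H₂ τ γ i)
        * loopFreeCost c γ) := by
    have h3 := pow_le_pow_left₀ h1' h1 2
    refine h3.trans ?_
    have h4 := sq_sum_le (fun i => visits_mem (H₁ := H₁) (H₂ := H₂) τ γ i) (H₁ + H₂)
    rw [← hN] at h4
    have h5 : loopFreeCost c γ ^ 2 ≤ loopFreeCost c γ := by nlinarith
    have h6 := mul_le_mul h4 h5 (sq_nonneg _) ((sq_nonneg _).trans h4)
    linarith
  have h3 : (marginal (H₁ + H₂) (skew lam q) γ - marginal (H₁ + H₂) (skew lam u) γ)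
      * estimator H₁ H₂ c q τ γ
      = (marginal (H₁ + H₂) (skew lam q) γ - marginal (H₁ + H₂) (skew lam u) γ)
          * (loopFreeCost c γ / marginal (H₁ + H₂) q γ)
          * ∑ i ∈ Finset.range (H₁ + H₂), visits H₁ H₂ τ γ i := by
    rw [← hN, estimator]
    ring
  rw [sum_sub_mul_eq, ← h3]
  have h5 := mul_le_mul_of_nonneg_left h2 hη.le
  rw [hlam] at *
  linarith

theorem abs_estimator_le {c : (Σ s, A s) → ℝ} (hc : ∀ γ, c γ ∈ Set.Icc (0 : ℝ) 1)
    (hq : IsLoopFreeOcc M H₁ H₂ T q) (τ : Traj A) (γ : Option (Σ s, A s)) :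
    |estimator H₁ H₂ c q τ γ| ≤ ((H₁ + H₂ : ℕ) : ℝ) / marginal (H₁ + H₂) q γ := by
  rw [abs_of_nonneg (estimator_nonneg hc hq τ γ), estimator]
  refine div_le_div_of_nonneg_right ?_ (hq.marginal_nonneg γ)
  have h1 : marginal (H₁ + H₂) (visits H₁ H₂ τ) γ ≤ ((H₁ + H₂ : ℕ) : ℝ) := by
    simpa [marginal] using Finset.sum_le_card_nsmul (Finset.range (H₁ + H₂))
      (visits H₁ H₂ τ γ) 1 fun i _ => (visits_mem τ γ i).2
  have h2 := loopFreeCost_mem hc γ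
  have h3 : 0 ≤ marginal (H₁ + H₂) (visits H₁ H₂ τ) γ :=
    Finset.sum_nonneg fun i _ => (visits_mem τ γ i).1
  nlinarith [h2.1, h2.2]

theorem integrable_omdGain (η lam : ℝ) (u : Occ A) {c : (Σ s, A s) → ℝ}
    (hc : ∀ γ, c γ ∈ Set.Icc (0 : ℝ) 1) (hq : IsLoopFreeOcc M H₁ H₂ T q) (π : Policy A) :
    Integrable (fun τ => omdGain H₁ H₂ η lam u c q τ) (M.episodeLaw π M.s₀) := by
  have h1 : ∀ r γ, Integrable (fun τ => r * estimator H₁ H₂ c q τ γ) (M.episodeLaw π M.s₀) :=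
    fun r γ => (Integrable.of_bound (measurable_estimator c γ).aestronglyMeasurable _
      (.of_forall fun τ => abs_estimator_le hc hq τ γ)).const_mul r
  refine (integrable_finsetSum _ fun γ _ => h1 _ γ).sub
    ((integrable_finsetSum _ fun γ _ => ?_).const_mul _)
  refine Integrable.of_bound (((measurable_estimator c γ).const_mul _).pow_const
    2).aestronglyMeasurable ((|marginal (H₁ + H₂) (skew lam q) γ|
      * (((H₁ + H₂ : ℕ) : ℝ) / marginal (H₁ + H₂) q γ)) ^ 2) (.of_forall fun τ => ?_)
  rw [Real.norm_eq_abs, abs_pow, abs_mul]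
  exact pow_le_pow_left₀ (by positivity)
    (mul_le_mul_of_nonneg_left (abs_estimator_le hc hq τ γ) (abs_nonneg _)) 2

/-- In expectation the variance penalty is `lam * ∑ h q c`, which is exactly the difference of the
skewed and the plain cost of `q`. Subtracting it from `⟨φ_q, c⟩` leaves `⟨q, c⟩`. -/
theorem integral_omdGain_ge (hH : 0 < H₁) {η lam : ℝ} (hη : 0 < η) (hlam : lam = 8 * η)
    (hl : lam * ((H₁ : ℝ) + H₂) ≤ 1) {u : Occ A} (hu : IsLoopFreeOcc M H₁ H₂ T u)
    {c : (Σ s, A s) → ℝ} (hc : ∀ γ, c γ ∈ Set.Icc (0 : ℝ) 1) (hq : q ∈ Feasible M H₁ H₂ T) :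
    ∑ γ, marginal (H₁ + H₂) q γ * loopFreeCost c γ
      ≤ ∫ τ, omdGain H₁ H₂ η lam u c q τ ∂M.episodeLaw (execPolicy H₁ πf q) M.s₀
        + ∑ γ, marginal (H₁ + H₂) (skew lam u) γ * loopFreeCost c γ := by
  have h1 := integral_mono (μ := M.episodeLaw (execPolicy H₁ πf q) M.s₀)
    (integrable_finsetSum _ fun γ _ => integrable_finsetSum _ fun i _ =>
      (integrable_visits _ γ i).const_mul _)
    (integrable_omdGain η lam u hc hq.1 _) (fun τ => omdGain_ge hη hlam hl u hc hq.1 τ)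
  rw [integral_sum_visits hH hq.1] at h1
  refine le_trans (le_of_eq ?_) (add_le_add h1 le_rfl)
  rw [← Finset.sum_add_distrib]
  refine Finset.sum_congr rfl fun γ _ => ?_
  have h2 : marginal (H₁ + H₂) (skew lam q) γ = marginal (H₁ + H₂) q γ
      + lam * ∑ i ∈ Finset.range (H₁ + H₂), ((i : ℝ) + 1) * q γ i := by
    rw [marginal_skew, marginal, Finset.mul_sum, ← Finset.sum_add_distrib]
    exact Finset.sum_congr rfl fun i _ => by ring
  have h3 : ∑ i ∈ Finset.range (H₁ + H₂), ((marginal (H₁ + H₂) (skew lam q) γ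
        - marginal (H₁ + H₂) (skew lam u) γ) * (loopFreeCost c γ / marginal (H₁ + H₂) q γ)
          - lam * (i + 1) * loopFreeCost c γ) * q γ i
      = (marginal (H₁ + H₂) (skew lam q) γ - marginal (H₁ + H₂) (skew lam u) γ)
          * (loopFreeCost c γ / marginal (H₁ + H₂) q γ) * marginal (H₁ + H₂) q γ
        - loopFreeCost c γ * (lam * ∑ i ∈ Finset.range (H₁ + H₂), ((i : ℝ) + 1) * q γ i) := by
    exact sum_sub_mul_eq ..
  rw [h3]
  by_cases hγ : γ ∈ active M H₁ H₂ T
  · have h4 := (hq.2 γ hγ).ne'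
    rw [mul_assoc, div_mul_cancel₀ _ h4]
    linear_combination (-loopFreeCost c γ) * h2
  · rw [hq.1.marginal_skew_eq_zero lam hγ, hu.marginal_skew_eq_zero lam hγ]
    rw [hq.1.marginal_skew_eq_zero lam hγ] at h2
    linear_combination (-loopFreeCost c γ) * h2

end

section

/-! ### The comparator -/

variable {S : Type u} {A : S → Type v} [Fintype S] [∀ s, Fintype (A s)]
variable {M : MDP S A} {H₁ H₂ : ℕ} {T : ℝ}

variable (M H₁ H₂) in
/-- The occupancy measure of the policy `π` in the loop-free instance. -/
def policyOcc (π : Policy A) : Occ A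
  | some γ, i => if i < H₁ then M.occ π M.s₀ i γ else 0
  | none, i => if H₁ ≤ i ∧ i < H₁ + H₂ then ∑ γ, M.occ π M.s₀ (H₁ - 1) γ else 0

theorem policyOcc_some {π : Policy A} {i : ℕ} (hi : i < H₁) (γ : Σ s, A s) :
    policyOcc M H₁ H₂ π (some γ) i = M.occ π M.s₀ i γ := if_pos hi

theorem isLoopFreeOcc_policyOcc (hH : 0 < H₁) {π : Policy A}
    (hT : ∑ i ∈ Finset.range H₁, ∑ γ, M.occ π M.s₀ i γ + H₂ * ∑ γ, M.occ π M.s₀ (H₁ - 1) γ ≤ T) :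
    IsLoopFreeOcc M H₁ H₂ T (policyOcc M H₁ H₂ π) where
  mem_unit γ i := by
    cases γ with
    | none =>
      simp only [policyOcc]
      split_ifs
      · rw [← M.measureReal_eval_ne_none]
        exact ⟨measureReal_nonneg, measureReal_le_one⟩
      · simp
    | some γ =>
      simp only [policyOcc]
      split_ifs
      · exact ⟨M.occ_nonneg .., M.occ_le_one ..⟩
      · simp
  layers γ i hi := by
    cases γ with
    | none => exact if_neg (by omega)
    | some γ => exact if_neg (by omega)
  total := by
    refine le_trans (le_of_eq ?_) hT
    rw [Fintype.sum_option, add_comm]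
    congr 1
    · rw [Finset.sum_comm]
      refine Finset.sum_congr rfl fun γ _ => ?_
      rw [marginal, Finset.sum_range_add, add_eq_left.2]
      · exact Finset.sum_congr rfl fun i hi => if_pos (Finset.mem_range.1 hi)
      · exact Finset.sum_eq_zero fun i _ => if_neg (by omega)
    · rw [marginal, Finset.sum_range_add, Finset.sum_eq_zero, zero_add]
      · refine (Finset.sum_congr rfl fun i hi => if_pos ⟨Nat.le_add_right H₁ i,
          Nat.add_lt_add_left (Finset.mem_range.1 hi) H₁⟩).trans ?_
        rw [Finset.sum_const, Finset.card_range, nsmul_eq_mul]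
      · exact fun i hi => if_neg fun h => absurd h.1 (not_le.2 (Finset.mem_range.1 hi))
  initial := by
    simp only [policyOcc_some hH, MDP.occ_zero, if_true]
    exact sum_toReal_eq_one _
  initial_ne s a hs := by
    rw [policyOcc_some hH, MDP.occ_zero, if_neg hs]
  late γ i hi := if_neg (not_lt.2 hi)
  fast i hi := by
    have h : ∀ γ, policyOcc M H₁ H₂ π (some γ) (H₁ - 1) = M.occ π M.s₀ (H₁ - 1) γ := fun γ =>
      policyOcc_some (by omega) γ
    simp only [h]
    simp only [policyOcc, hi, and_true]
  flow s i hi := by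
    simp only [policyOcc_some hi, policyOcc_some (show i < H₁ by omega), MDP.occ_succ]
    rw [← Finset.mul_sum, sum_toReal_eq_one, mul_one]
    exact Finset.sum_congr rfl fun γ _ => mul_comm _ _

theorem sum_marginal_skew_policyOcc (lam : ℝ) (π : Policy A) (l : (Σ s, A s) → ℝ) :
    ∑ γ, marginal (H₁ + H₂) (skew lam (policyOcc M H₁ H₂ π)) (some γ) * l γ
      = ∑ i ∈ Finset.range H₁, ∑ γ, M.occ π M.s₀ i γ * l γ
        + lam * ∑ i ∈ Finset.range H₁, ((i : ℝ) + 1) * ∑ γ, M.occ π M.s₀ i γ * l γ := by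
  rw [Finset.mul_sum, ← Finset.sum_add_distrib]
  have h : ∀ γ, marginal (H₁ + H₂) (skew lam (policyOcc M H₁ H₂ π)) (some γ) * l γ
      = ∑ i ∈ Finset.range H₁, (1 + lam * (i + 1)) * (M.occ π M.s₀ i γ * l γ) := by
    intro γ
    rw [marginal_skew, Finset.sum_range_add, add_eq_left.2, Finset.sum_mul]
    · refine Finset.sum_congr rfl fun i hi => ?_
      rw [policyOcc_some (Finset.mem_range.1 hi), mul_assoc]
    · refine Finset.sum_eq_zero fun i _ => ?_
      simp [policyOcc]
  simp only [h]
  rw [Finset.sum_comm]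
  refine Finset.sum_congr rfl fun i _ => ?_
  rw [← Finset.mul_sum]
  ring

section Best

variable {K : ℕ} {c : ℕ → (Σ s, A s) → ℝ} {f : (s : S) → A s}

/-- Truncation adds at most `H₂ * (2 / K ^ 2) ≤ 1` to the expected time; this is the `+ 1` in the
hypothesis on `T`. -/
theorem MDP.Proper.isLoopFreeOcc_policyOcc (hf : M.Proper f) (hH : 0 < H₁) (hK : 2 ≤ K)
    (hHK : 2 * (H₂ : ℝ) ≤ K) (hlog : ∀ s, 8 * M.value f 1 s * Real.log K ≤ H₁)
    (hT : M.value f 1 M.s₀ + 1 ≤ T) :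
    IsLoopFreeOcc M H₁ H₂ T (policyOcc M H₁ H₂ (detPolicy f)) := by
  have hK0 : (2 : ℝ) ≤ K := by exact_mod_cast hK
  refine SSP.isLoopFreeOcc_policyOcc hH (le_trans (add_le_add ?_ ?_) hT)
  · have h : ∀ i, ∑ γ, M.occ (detPolicy f) M.s₀ i γ = (M.next f ^ i) 1 M.s₀ := fun i => by
      have := M.sum_occ_detPolicy f M.s₀ i (fun _ => 1)
      simp only [mul_one] at this
      exact this
    simp only [h]
    exact hf.sum_le_value zero_le_one _ _
  · have h := M.sum_occ_detPolicy f M.s₀ (H₁ - 1) (fun _ => 1)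
    simp only [mul_one] at h
    rw [h]
    refine (mul_le_mul_of_nonneg_left (hf.next_pow_one_le hK hH hlog M.s₀)
      (Nat.cast_nonneg _)).trans ?_
    rw [mul_div_assoc', div_le_one (by positivity)]
    nlinarith

/-- The skewed cost of the best policy in the loop-free instance. -/
theorem MDP.IsBest.sum_skew_le {lam : ℝ} (hlam : 0 ≤ lam) (hl : lam * ((H₁ : ℝ) + H₂) ≤ 1)
    (hc : ∀ k γ, c k γ ∈ Set.Icc (0 : ℝ) 1) (hf : M.IsBest c K f) {πf : (s : S) → A s}
    (hg : M.IsFast πf) (hD : M.diameter.toReal ≤ H₂) (hH : 0 < H₁) (hK : 2 ≤ K)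
    (hHK : 4 * ((H₁ : ℝ) + H₂) ≤ K) (hlog : ∀ s, 8 * M.value f 1 s * Real.log K ≤ H₁)
    (hT : M.value f 1 M.s₀ + 1 ≤ T) :
    ∑ k ∈ Finset.range K, ∑ γ,
        marginal (H₁ + H₂) (skew lam (policyOcc M H₁ H₂ (detPolicy f))) γ * loopFreeCost (c k) γ
      ≤ ∑ k ∈ Finset.range K, (M.costToGo (c k) f M.s₀).toReal
        + 3 * (lam * (K * M.diameter.toReal * M.value f 1 M.s₀)) + 1 := by
  have hp := hf.1
  have hK0 : (2 : ℝ) ≤ K := by exact_mod_cast hK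
  have hH0 : (0 : ℝ) ≤ H₁ := Nat.cast_nonneg _
  have hH2 : (0 : ℝ) ≤ H₂ := Nat.cast_nonneg _
  have hq := hp.isLoopFreeOcc_policyOcc (H₂ := H₂) hH hK (by linarith) hlog hT
  have hD1 : 1 ≤ M.diameter.toReal := (hg.1.one_le_value M.s₀).trans (hg.value_le_diameter M.s₀)
  have ht1 := hp.one_le_value M.s₀
  -- The skew at most doubles `H₂ * (2 / K ^ 2)`, and `4 * H₂ ≤ K`. Over `K` episodes the fast state
  -- therefore costs at most `1`.
  have hnone : marginal (H₁ + H₂) (skew lam (policyOcc M H₁ H₂ (detPolicy f))) none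
      ≤ 1 / K := by
    refine (hq.marginal_skew_le hlam hl none).trans ?_
    rw [hq.marginal_none]
    have h1 : ∑ γ, policyOcc M H₁ H₂ (detPolicy f) (some γ) (H₁ - 1) ≤ 2 / (K : ℝ) ^ 2 := by
      have h := M.sum_occ_detPolicy f M.s₀ (H₁ - 1) (fun _ => 1)
      simp only [mul_one] at h
      rw [Finset.sum_congr rfl fun γ _ => policyOcc_some (show H₁ - 1 < H₁ by omega) γ, h]
      exact hp.next_pow_one_le hK hH hlog M.s₀
    have h2 := mul_le_mul_of_nonneg_left h1 hH2
    refine (mul_le_mul_of_nonneg_left h2 zero_le_two).trans ?_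
    rw [mul_div_assoc', mul_div_assoc', div_le_div_iff₀ (by positivity) (by positivity)]
    nlinarith
  have hsplit : ∀ k, ∑ γ, marginal (H₁ + H₂) (skew lam (policyOcc M H₁ H₂ (detPolicy f))) γ
        * loopFreeCost (c k) γ
      ≤ 1 / K + ((M.costToGo (c k) f M.s₀).toReal
        + lam * ∑ i ∈ Finset.range H₁, ((i : ℝ) + 1)
          * (M.next f ^ i) (fun s => c k ⟨s, f s⟩) M.s₀) := by
    intro k
    rw [Fintype.sum_option, loopFreeCost, mul_one]
    refine add_le_add hnone ?_
    have h := sum_marginal_skew_policyOcc (M := M) (H₁ := H₁) (H₂ := H₂) lam (detPolicy f) (c k)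
    simp only [M.sum_occ_detPolicy] at h
    refine h.le.trans (add_le_add ?_ le_rfl)
    rw [hp.toReal_costToGo fun γ => (hc k γ).1]
    exact hp.sum_le_value (fun s => (hc k _).1) _ _
  refine (Finset.sum_le_sum fun k _ => hsplit k).trans ?_
  rw [Finset.sum_add_distrib, Finset.sum_add_distrib, Finset.sum_const, Finset.card_range,
    nsmul_eq_mul, mul_one_div_cancel (by positivity), ← Finset.mul_sum]
  have hw := hf.sum_weighted_le hc hg H₁
  have e : ∑ i ∈ Finset.range H₁, ((i : ℝ) + 1)
        * (M.next f ^ i) (fun s => ∑ k ∈ Finset.range K, c k ⟨s, f s⟩) M.s₀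
      = ∑ k ∈ Finset.range K, ∑ i ∈ Finset.range H₁, ((i : ℝ) + 1)
        * (M.next f ^ i) (fun s => c k ⟨s, f s⟩) M.s₀ := by
    rw [Finset.sum_comm]
    refine Finset.sum_congr rfl fun i _ => ?_
    have e' : (fun s => ∑ k ∈ Finset.range K, c k ⟨s, f s⟩)
        = ∑ k ∈ Finset.range K, fun s => c k ⟨s, f s⟩ := by
      ext s
      simp
    rw [e', map_sum, Finset.sum_apply, Finset.mul_sum]
  rw [← e]
  -- As the diameter is at least `1`, both `K + 1 ≤ 2 * K` and `H₁ ≤ K` are absorbed into multiples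
  -- of `K * D`.
  have h3 : ((K + 1) * M.diameter.toReal + H₁) * M.value f 1 M.s₀
      ≤ 3 * (K * M.diameter.toReal * M.value f 1 M.s₀) := by
    rw [← mul_assoc]
    refine mul_le_mul_of_nonneg_right ?_ (by linarith)
    nlinarith
  have h4 := mul_le_mul_of_nonneg_left (hw.trans h3) hlam
  linarith

/-- The skewed cost of the best policy, mixed with a small multiple of another point. -/
theorem MDP.IsBest.sum_skew_mix_le {lam : ℝ} (hlam : 0 ≤ lam) (hl : lam * ((H₁ : ℝ) + H₂) ≤ 1)
    (hc : ∀ k γ, c k γ ∈ Set.Icc (0 : ℝ) 1) (hf : M.IsBest c K f) {πf : (s : S) → A s}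
    (hg : M.IsFast πf) (hD : M.diameter.toReal ≤ H₂) (hH : 0 < H₁) (hK : 2 ≤ K)
    (hHK : 4 * ((H₁ : ℝ) + H₂) ≤ K) (hlog : ∀ s, 8 * M.value f 1 s * Real.log K ≤ H₁)
    (hT : M.value f 1 M.s₀ + 1 ≤ T) {q₁ : Occ A} (hq₁ : IsLoopFreeOcc M H₁ H₂ T q₁) :
    ∑ k ∈ Finset.range K, ∑ γ,
        marginal (H₁ + H₂) (skew lam (mix (1 - 1 / (T * K)) q₁
          (policyOcc M H₁ H₂ (detPolicy f)))) γ * loopFreeCost (c k) γ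
      ≤ ∑ k ∈ Finset.range K, (M.costToGo (c k) f M.s₀).toReal
        + 3 * (lam * (K * M.diameter.toReal * M.value f 1 M.s₀)) + 3 := by
  have h := hf.sum_skew_le hlam hl hc hg hD hH hK hHK hlog hT
  have hK0 : (2 : ℝ) ≤ K := by exact_mod_cast hK
  have ht1 := hf.1.one_le_value M.s₀
  have hT0 : 0 < T := by linarith
  have hq := hf.1.isLoopFreeOcc_policyOcc (H₂ := H₂) hH hK
    (by linarith [(Nat.cast_nonneg H₁ : (0 : ℝ) ≤ H₁)]) hlog hT
  have hε : 0 ≤ 1 / (T * K) := by positivity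
  have h1 : ∑ k ∈ Finset.range K, ∑ γ, marginal (H₁ + H₂) (skew lam q₁) γ * loopFreeCost (c k) γ
      ≤ 2 * (T * K) := by
    have h2 : ∀ k ∈ Finset.range K, ∑ γ, marginal (H₁ + H₂) (skew lam q₁) γ * loopFreeCost (c k) γ
        ≤ 2 * T := by
      intro k _
      refine le_trans (Finset.sum_le_sum fun γ _ => ?_)
        ((Finset.mul_sum _ _ _).symm.le.trans (mul_le_mul_of_nonneg_left hq₁.total zero_le_two))
      exact (mul_le_of_le_one_right ((hq₁.marginal_nonneg γ).trans (hq₁.marginal_le_skew hlam γ))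
        (loopFreeCost_mem (hc k) γ).2).trans (hq₁.marginal_skew_le hlam hl γ)
    refine (Finset.sum_le_sum h2).trans (le_of_eq ?_)
    rw [Finset.sum_const, Finset.card_range, nsmul_eq_mul]
    ring
  have h2 : 1 / (T * K) * ∑ k ∈ Finset.range K, ∑ γ,
      marginal (H₁ + H₂) (skew lam q₁) γ * loopFreeCost (c k) γ ≤ 2 := by
    refine (mul_le_mul_of_nonneg_left h1 hε).trans (le_of_eq ?_)
    field_simp
  refine le_trans ?_ (by linarith [add_le_add h h2] : ∑ k ∈ Finset.range K, ∑ γ,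
        marginal (H₁ + H₂) (skew lam (policyOcc M H₁ H₂ (detPolicy f))) γ * loopFreeCost (c k) γ
      + 1 / (T * K) * ∑ k ∈ Finset.range K, ∑ γ,
      marginal (H₁ + H₂) (skew lam q₁) γ * loopFreeCost (c k) γ ≤ _)
  rw [Finset.mul_sum, ← Finset.sum_add_distrib]
  refine Finset.sum_le_sum fun k _ => ?_
  rw [Finset.mul_sum, ← Finset.sum_add_distrib]
  refine Finset.sum_le_sum fun γ _ => ?_
  rw [marginal_skew_mix]
  have h3 : 0 ≤ marginal (H₁ + H₂) (skew lam (policyOcc M H₁ H₂ (detPolicy f))) γ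
      * loopFreeCost (c k) γ :=
    mul_nonneg ((hq.marginal_nonneg γ).trans (hq.marginal_le_skew hlam γ))
      (loopFreeCost_mem (hc k) γ).1
  nlinarith [mul_nonneg hε h3]

end Best

end

section

/-! ### The run of the learner -/

section Congr

variable {S : Type u} {A : S → Type v} {H₁ H₂ : ℕ}

theorem visits_congr (hH : 0 < H₁) {τ τ' : Traj A} (h : ∀ i < H₁, τ i = τ' i) :
    visits H₁ H₂ τ = visits H₁ H₂ τ' := by
  ext γ i
  cases γ with
  | none => simp only [visits, h (H₁ - 1) (by omega)]
  | some γ =>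
    by_cases hi : i < H₁
    · simp only [visits]
      rw [h i hi]
    · simp only [visits, hi, false_and, if_false]

theorem estimator_congr (hH : 0 < H₁) {τ τ' : Traj A} (h : ∀ i < H₁, τ i = τ' i)
    (c : (Σ s, A s) → ℝ) (q : Occ A) : estimator H₁ H₂ c q τ = estimator H₁ H₂ c q τ' := by
  ext γ
  simp only [estimator, visits_congr hH h]

/-- The update sees an episode only through its first `H₁` entries. So each iterate takes finitely
many values, and measurability holds for an arbitrary tie-breaking rule `upd`. -/
theorem iterate_congr (hH : 0 < H₁) (q₁ : Occ A)
    (upd : Occ A → (Option (Σ s, A s) → ℝ) → Occ A) (c : ℕ → (Σ s, A s) → ℝ)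
    {k : ℕ} {ω ω' : ℕ → Traj A} (h : ∀ j < k, ∀ i < H₁, ω j i = ω' j i) :
    iterate H₁ H₂ q₁ upd c k ω = iterate H₁ H₂ q₁ upd c k ω' := by
  induction k with
  | zero => rfl
  | succ k ih =>
    simp only [iterate]
    rw [ih fun j hj => h j (by omega), estimator_congr hH (h k (by omega))]

theorem extend_apply (n : ℕ) (ω : ℕ → Traj A) {j i : ℕ} (hj : j ≤ n) (hi : i < H₁) :
    extend (fun (j : Finset.Iic n) (i : Fin H₁) => ω j i) j i = ω j i := by
  rw [extend, dif_pos ⟨hj, hi⟩]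

theorem iterate_eq_extend (hH : 0 < H₁) {k n : ℕ} (hk : k ≤ n + 1) (ω : ℕ → Traj A) (q₁ : Occ A)
    (upd : Occ A → (Option (Σ s, A s) → ℝ) → Occ A) (c : ℕ → (Σ s, A s) → ℝ) :
    iterate H₁ H₂ q₁ upd c k ω
      = iterate H₁ H₂ q₁ upd c k (extend fun (j : Finset.Iic n) (i : Fin H₁) => ω j i) :=
  iterate_congr hH q₁ upd c fun j hj i hi => (extend_apply n ω (by omega) hi).symm

end Congr

variable {S : Type u} {A : S → Type v} [Fintype S] [∀ s, Fintype (A s)]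
variable {M : MDP S A} {H₁ H₂ : ℕ} {T η lam : ℝ} {πf : (s : S) → A s} {q₁ : Occ A}
  {upd : Occ A → (Option (Σ s, A s) → ℝ) → Occ A} {c : ℕ → (Σ s, A s) → ℝ}

theorem omdGain_congr (hH : 0 < H₁) {τ τ' : Traj A} (h : ∀ i < H₁, τ i = τ' i) (u : Occ A)
    (c : (Σ s, A s) → ℝ) (q : Occ A) :
    omdGain H₁ H₂ η lam u c q τ = omdGain H₁ H₂ η lam u c q τ' := by
  simp only [omdGain, estimator_congr hH h]

theorem IsOMD.iterate_mem (h : IsOMD M H₁ H₂ T η lam q₁ upd)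
    (hc : ∀ k γ, c k γ ∈ Set.Icc (0 : ℝ) 1) (k : ℕ) (ω : ℕ → Traj A) :
    iterate H₁ H₂ q₁ upd c k ω ∈ Feasible M H₁ H₂ T := by
  induction k with
  | zero => exact h.init_mem
  | succ k ih => exact h.update_mem _ ih _ (estimator_nonneg (hc k) ih.1 (ω k))

/-- The guarantee of online mirror descent along a run. -/
theorem IsOMD.sum_omdGain_le (h : IsOMD M H₁ H₂ T η lam q₁ upd) (hη : 0 < η) (hlam : 0 ≤ lam)
    (hc : ∀ k γ, c k γ ∈ Set.Icc (0 : ℝ) 1) {u : Occ A} (hu : u ∈ Feasible M H₁ H₂ T)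
    (K : ℕ) (ω : ℕ → Traj A) :
    ∑ k ∈ Finset.range K, omdGain H₁ H₂ η lam u (c k) (iterate H₁ H₂ q₁ upd c k ω) (ω k)
      ≤ barrierDiv M H₁ H₂ T η (marginal (H₁ + H₂) (skew lam u))
        (marginal (H₁ + H₂) (skew lam q₁)) := by
  -- The last divergence is kept in the statement so that the induction telescopes; it is dropped at
  -- the end by nonnegativity.
  have key : ∑ k ∈ Finset.range K, omdGain H₁ H₂ η lam u (c k) (iterate H₁ H₂ q₁ upd c k ω) (ω k)
      ≤ barrierDiv M H₁ H₂ T η (marginal (H₁ + H₂) (skew lam u))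
          (marginal (H₁ + H₂) (skew lam q₁))
        - barrierDiv M H₁ H₂ T η (marginal (H₁ + H₂) (skew lam u))
          (marginal (H₁ + H₂) (skew lam (iterate H₁ H₂ q₁ upd c K ω))) := by
    induction K with
    | zero => simp [iterate]
    | succ K ih =>
      have hq := h.iterate_mem hc K ω
      have he := estimator_nonneg (hc K) hq.1 (ω K)
      have hs := omd_step hη hlam he (h.update _ hq _ he) (h.update_mem _ hq _ he) hq hu
      rw [Finset.sum_range_succ, iterate, omdGain]
      linarith
  refine key.trans (sub_le_self _ ?_)
  exact barrierDiv_nonneg hη (fun γ hγ => skew_pos_of_mem hu hlam hγ)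
    (fun γ hγ => skew_pos_of_mem (h.iterate_mem hc K ω) hlam hγ)

/-- A function of finitely many entries of a run is bounded and measurable. -/
theorem integrable_of_extend {n : ℕ} {g : (ℕ → Traj A) → ℝ}
    (hg : ∀ ω, g ω = g (extend fun (j : Finset.Iic n) (i : Fin H₁) => ω j i))
    (P : Measure (ℕ → Traj A)) [IsFiniteMeasure P] : Integrable g P := by
  obtain ⟨B, hB⟩ : ∃ B, ∀ y : Finset.Iic n → Fin H₁ → Step A, ‖g (extend y)‖ ≤ B := by
    obtain ⟨B, hB⟩ := (Set.finite_range fun y : Finset.Iic n → Fin H₁ → Step A =>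
      ‖g (extend y)‖).bddAbove
    exact ⟨B, fun y => hB ⟨y, rfl⟩⟩
  have hm : Measurable g := by
    have : g = (fun y : Finset.Iic n → Fin H₁ → Step A => g (extend y))
        ∘ fun ω (j : Finset.Iic n) (i : Fin H₁) => ω j i := funext hg
    rw [this]
    exact (measurable_of_countable _).comp (by fun_prop)
  refine Integrable.of_bound hm.aestronglyMeasurable B (.of_forall fun ω => ?_)
  rw [hg]
  exact hB _

theorem measurable_iterate_succ {β : Type*} [MeasurableSpace β] {F : Occ A → Traj A → β}
    (hF : ∀ q, Measurable (F q)) (n : ℕ) :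
    Measurable fun p : (Finset.Iic n → Traj A) × Traj A =>
      F (iterate H₁ H₂ q₁ upd c (n + 1) (extend fun j (i : Fin H₁) => p.1 j i)) p.2 := by
  have h : Measurable fun p : (Finset.Iic n → Fin H₁ → Step A) × Traj A =>
      F (iterate H₁ H₂ q₁ upd c (n + 1) (extend p.1)) p.2 :=
    measurable_from_prod_countable_right fun y => hF (iterate H₁ H₂ q₁ upd c (n + 1) (extend y))
  exact h.comp (by fun_prop : Measurable fun p : (Finset.Iic n → Traj A) × Traj A =>
    ((fun j (i : Fin H₁) => p.1 j i : Finset.Iic n → Fin H₁ → Step A), p.2))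

/-- Conditionally on the past, an episode has the law of the policy of the current point. -/
theorem lintegral_runLaw (hH : 0 < H₁) {F : Occ A → Traj A → ℝ≥0∞} (hF : ∀ q, Measurable (F q))
    (k : ℕ) :
    ∫⁻ ω, F (iterate H₁ H₂ q₁ upd c k ω) (ω k) ∂runLaw M H₁ H₂ πf q₁ upd c
      = ∫⁻ ω, ∫⁻ τ, F (iterate H₁ H₂ q₁ upd c k ω) τ
          ∂M.episodeLaw (execPolicy H₁ πf (iterate H₁ H₂ q₁ upd c k ω)) M.s₀
          ∂runLaw M H₁ H₂ πf q₁ upd c := by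
  cases k with
  | zero =>
    simp only [iterate, lintegral_const, measure_univ, mul_one]
    have h := map_eval_zero_trajMeasure (X := fun _ => Traj A)
      (M.episodeLaw (execPolicy H₁ πf q₁) M.s₀) (episodeKernel M H₁ H₂ πf q₁ upd c)
    conv_rhs => rw [← h]
    rw [lintegral_map (hF q₁) (measurable_pi_apply 0)]
    rfl
  | succ n =>
    have h := lintegral_trajMeasure_succ (X := fun _ => Traj A)
      (M.episodeLaw (execPolicy H₁ πf q₁) M.s₀) (episodeKernel M H₁ H₂ πf q₁ upd c) n
      (measurable_iterate_succ (H₁ := H₁) (H₂ := H₂) (q₁ := q₁) (upd := upd) (c := c) hF n)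
    have e : ∀ ω : ℕ → Traj A, iterate H₁ H₂ q₁ upd c (n + 1)
        (extend fun (j : Finset.Iic n) (i : Fin H₁) => Preorder.frestrictLe n ω j i)
        = iterate H₁ H₂ q₁ upd c (n + 1) ω := fun ω => (iterate_eq_extend hH le_rfl ω q₁ upd c).symm
    have e2 : ∀ ω : ℕ → Traj A, episodeKernel M H₁ H₂ πf q₁ upd c n (Preorder.frestrictLe n ω)
        = M.episodeLaw (execPolicy H₁ πf (iterate H₁ H₂ q₁ upd c (n + 1) ω)) M.s₀ := fun ω => by
      rw [← e]
      rfl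
    simp only [e, e2] at h
    exact h

theorem integral_runLaw (hH : 0 < H₁) {F : Occ A → Traj A → ℝ} (hF : ∀ q, Measurable (F q))
    (k : ℕ) (hi : Integrable (fun ω => F (iterate H₁ H₂ q₁ upd c k ω) (ω k))
      (runLaw M H₁ H₂ πf q₁ upd c)) :
    ∫ ω, F (iterate H₁ H₂ q₁ upd c k ω) (ω k) ∂runLaw M H₁ H₂ πf q₁ upd c
      = ∫ ω, ∫ τ, F (iterate H₁ H₂ q₁ upd c k ω) τ
          ∂M.episodeLaw (execPolicy H₁ πf (iterate H₁ H₂ q₁ upd c k ω)) M.s₀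
          ∂runLaw M H₁ H₂ πf q₁ upd c := by
  cases k with
  | zero =>
    simp only [iterate, integral_const, probReal_univ, one_smul]
    have h := map_eval_zero_trajMeasure (X := fun _ => Traj A)
      (M.episodeLaw (execPolicy H₁ πf q₁) M.s₀) (episodeKernel M H₁ H₂ πf q₁ upd c)
    conv_rhs => rw [← h]
    rw [integral_map (measurable_pi_apply 0).aemeasurable (hF q₁).aestronglyMeasurable]
    rfl
  | succ n =>
    have e : ∀ ω : ℕ → Traj A, iterate H₁ H₂ q₁ upd c (n + 1)
        (extend fun (j : Finset.Iic n) (i : Fin H₁) => Preorder.frestrictLe n ω j i)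
        = iterate H₁ H₂ q₁ upd c (n + 1) ω := fun ω => (iterate_eq_extend hH le_rfl ω q₁ upd c).symm
    have e2 : ∀ ω : ℕ → Traj A, episodeKernel M H₁ H₂ πf q₁ upd c n (Preorder.frestrictLe n ω)
        = M.episodeLaw (execPolicy H₁ πf (iterate H₁ H₂ q₁ upd c (n + 1) ω)) M.s₀ := fun ω => by
      rw [← e]
      rfl
    have h := integral_trajMeasure_succ (X := fun _ => Traj A)
      (M.episodeLaw (execPolicy H₁ πf q₁) M.s₀) (episodeKernel M H₁ H₂ πf q₁ upd c) n
      (measurable_iterate_succ (H₁ := H₁) (H₂ := H₂) (q₁ := q₁) (upd := upd) (c := c) hF n)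
    simp only [e, e2] at h
    exact h hi

theorem integrable_omdGain_runLaw (hH : 0 < H₁) (u : Occ A) (k : ℕ) :
    Integrable (fun ω => omdGain H₁ H₂ η lam u (c k) (iterate H₁ H₂ q₁ upd c k ω) (ω k))
      (runLaw M H₁ H₂ πf q₁ upd c) := by
  refine integrable_of_extend (H₁ := H₁) (n := k) (fun ω => ?_) _
  rw [← iterate_eq_extend hH (Nat.le_succ k) ω]
  exact omdGain_congr hH (fun i hi => (extend_apply k ω le_rfl hi).symm) _ _ _

variable (h : IsOMD M H₁ H₂ T η lam q₁ upd) (hc : ∀ k γ, c k γ ∈ Set.Icc (0 : ℝ) 1)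
  (hH : 0 < H₁) (hf : M.IsFast πf) (hD : M.diameter.toReal ≤ H₂)
include h hc hH hf hD

theorem ae_reaches_runLaw (k : ℕ) :
    ∀ᵐ ω ∂runLaw M H₁ H₂ πf q₁ upd c, ∃ i, ω k i = none := by
  have hm : MeasurableSet {τ : Traj A | ∀ i, τ i ≠ none} := by
    have : {τ : Traj A | ∀ i, τ i ≠ none} = ⋂ i, {τ : Traj A | τ i ≠ none} := by ext; simp
    rw [this]
    exact MeasurableSet.iInter fun i => (MDP.measurableSet_eval_eq i none).compl
  have key := lintegral_runLaw (M := M) (πf := πf) (q₁ := q₁) (upd := upd) (c := c) (H₂ := H₂) hH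
    (F := fun _ => {τ : Traj A | ∀ i, τ i ≠ none}.indicator 1)
    (fun _ => measurable_one.indicator hm) k
  simp only [lintegral_indicator_one hm] at key
  have h0 : ∀ ω : ℕ → Traj A, M.episodeLaw (execPolicy H₁ πf (iterate H₁ H₂ q₁ upd c k ω)) M.s₀
      {τ : Traj A | ∀ i, τ i ≠ none} = 0 := fun ω => by
    have h1 := ae_reaches_execPolicy (πf := πf) hH hf hD (h.iterate_mem hc k ω).1
    rw [ae_iff] at h1
    simpa using h1
  simp only [h0, lintegral_zero] at key
  have hm' : MeasurableSet {ω : ℕ → Traj A | ∀ i, ω k i ≠ none} := hm.preimage (measurable_pi_apply k)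
  rw [ae_iff]
  have e : ∀ ω : ℕ → Traj A, {τ : Traj A | ∀ i, τ i ≠ none}.indicator (1 : Traj A → ℝ≥0∞) (ω k)
      = {ω : ℕ → Traj A | ∀ i, ω k i ≠ none}.indicator 1 ω := fun ω => rfl
  simp only [e, lintegral_indicator_one hm'] at key
  simpa using key

theorem integrable_cost_runLaw (k : ℕ) :
    Integrable (fun ω => ∑' i, stepCost (c k) (ω k i)) (runLaw M H₁ H₂ πf q₁ upd c) := by
  have key := lintegral_runLaw (M := M) (πf := πf) (q₁ := q₁) (upd := upd) (c := c) (H₂ := H₂) hH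
    (F := fun _ τ => ∑' i, ENNReal.ofReal (stepCost (c k) (τ i)))
    (fun _ => measurable_tsum_ofReal_stepCost (c k)) k
  have hb : ∫⁻ ω, ∑' i, ENNReal.ofReal (stepCost (c k) (ω k i)) ∂runLaw M H₁ H₂ πf q₁ upd c
      ≤ ENNReal.ofReal T := by
    rw [key]
    refine (lintegral_mono (g := fun _ => ENNReal.ofReal T) fun ω => ?_).trans (by simp)
    have hq := (h.iterate_mem hc k ω).1
    refine (lintegral_cost_execPolicy_le hH hf hD (hc k) hq).trans (ENNReal.ofReal_le_ofReal ?_)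
    exact (Finset.sum_le_sum fun γ _ => mul_le_of_le_one_right (hq.marginal_nonneg γ)
      (loopFreeCost_mem (hc k) γ).2).trans hq.total
  simp only [tsum_stepCost_eq fun γ => (hc k γ).1]
  refine integrable_toReal_of_lintegral_ne_top ?_ (ne_top_of_le_ne_top ENNReal.ofReal_ne_top hb)
  exact ((measurable_tsum_ofReal_stepCost (c k)).comp (measurable_pi_apply k)).aemeasurable

/-- The expected cost of an episode. -/
theorem integral_cost_runLaw_le (hη : 0 < η) (hlam : lam = 8 * η)
    (hl : lam * ((H₁ : ℝ) + H₂) ≤ 1) {u : Occ A} (hu : IsLoopFreeOcc M H₁ H₂ T u) (k : ℕ) :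
    ∫ ω, ∑' i, stepCost (c k) (ω k i) ∂runLaw M H₁ H₂ πf q₁ upd c
      ≤ ∫ ω, omdGain H₁ H₂ η lam u (c k) (iterate H₁ H₂ q₁ upd c k ω) (ω k)
          ∂runLaw M H₁ H₂ πf q₁ upd c
        + ∑ γ, marginal (H₁ + H₂) (skew lam u) γ * loopFreeCost (c k) γ := by
  set b := ∑ γ, marginal (H₁ + H₂) (skew lam u) γ * loopFreeCost (c k) γ with hb
  have hX := integrable_cost_runLaw h hc hH hf hD k
  have hY := integrable_omdGain_runLaw (M := M) (H₂ := H₂) (η := η) (lam := lam)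
    (πf := πf) (q₁ := q₁) (upd := upd) (c := c) hH u k
  -- Conditioning is applied to cost minus gain: for every past, its conditional expectation is at
  -- most the deterministic number `b`.
  have key := integral_runLaw (M := M) (πf := πf) (q₁ := q₁) (upd := upd) (c := c) (H₂ := H₂) hH
    (F := fun q τ => ∑' i, stepCost (c k) (τ i) - omdGain H₁ H₂ η lam u (c k) q τ)
    (fun q => (measurable_tsum_stepCost fun γ => (hc k γ).1).sub (measurable_omdGain _ _ _ _)) k
    (hX.sub hY)
  rw [integral_sub hX hY] at key
  rw [← sub_le_iff_le_add', key]
  refine (integral_mono (g := fun _ => b) ?_ (integrable_const _) fun ω => ?_).trans (by simp)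
  · refine integrable_of_extend (H₁ := H₁) (n := k) (fun ω => ?_) _
    rw [← iterate_eq_extend hH (Nat.le_succ k) ω]
  · have hq := h.iterate_mem hc k ω
    have hcost := lintegral_cost_execPolicy_le (πf := πf) hH hf hD (hc k) hq.1
    have hXi : Integrable (fun τ : Traj A => ∑' i, stepCost (c k) (τ i))
        (M.episodeLaw (execPolicy H₁ πf (iterate H₁ H₂ q₁ upd c k ω)) M.s₀) := by
      simp only [tsum_stepCost_eq fun γ => (hc k γ).1]
      exact integrable_toReal_of_lintegral_ne_top
        (measurable_tsum_ofReal_stepCost (c k)).aemeasurable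
        (ne_top_of_le_ne_top ENNReal.ofReal_ne_top hcost)
    have hYi := integrable_omdGain (M := M) η lam u (hc k) hq.1
      (execPolicy H₁ πf (iterate H₁ H₂ q₁ upd c k ω))
    have hgain := integral_omdGain_ge (πf := πf) hH hη hlam hl hu (hc k) hq
    have hint : ∫ τ, ∑' i, stepCost (c k) (τ i)
        ∂M.episodeLaw (execPolicy H₁ πf (iterate H₁ H₂ q₁ upd c k ω)) M.s₀
        ≤ ∑ γ, marginal (H₁ + H₂) (iterate H₁ H₂ q₁ upd c k ω) γ * loopFreeCost (c k) γ := by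
      simp only [tsum_stepCost_eq fun γ => (hc k γ).1]
      rw [integral_toReal (measurable_tsum_ofReal_stepCost (c k)).aemeasurable
        (ae_lt_top (measurable_tsum_ofReal_stepCost (c k))
          (ne_top_of_le_ne_top ENNReal.ofReal_ne_top hcost))]
      refine ENNReal.toReal_le_of_le_ofReal (Finset.sum_nonneg fun γ _ => ?_) hcost
      exact mul_nonneg (hq.1.marginal_nonneg γ) (loopFreeCost_mem (hc k) γ).1
    simp only
    rw [integral_sub hXi hYi]
    linarith

theorem integrable_regret (K : ℕ) (f : (s : S) → A s) :
    Integrable (M.regret c K f) (runLaw M H₁ H₂ πf q₁ upd c) :=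
  (integrable_finsetSum _ fun k _ => integrable_cost_runLaw h hc hH hf hD k).sub
    (integrable_const _)

theorem integral_regret_le (hη : 0 < η) (hlam : lam = 8 * η)
    (hl : lam * ((H₁ : ℝ) + H₂) ≤ 1) {u : Occ A} (hu : u ∈ Feasible M H₁ H₂ T) (K : ℕ)
    (f : (s : S) → A s) :
    ∫ ω, M.regret c K f ω ∂runLaw M H₁ H₂ πf q₁ upd c
      ≤ barrierDiv M H₁ H₂ T η (marginal (H₁ + H₂) (skew lam u))
          (marginal (H₁ + H₂) (skew lam q₁))
        + ∑ k ∈ Finset.range K, ∑ γ, marginal (H₁ + H₂) (skew lam u) γ * loopFreeCost (c k) γ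
        - ∑ k ∈ Finset.range K, (M.costToGo (c k) f M.s₀).toReal := by
  have hX := fun k => integrable_cost_runLaw h hc hH hf hD k
  have hY := fun k => integrable_omdGain_runLaw (M := M) (H₂ := H₂) (η := η) (lam := lam)
    (πf := πf) (q₁ := q₁) (upd := upd) (c := c) hH u k
  simp only [MDP.regret]
  rw [integral_sub (integrable_finsetSum _ fun k _ => hX k) (integrable_const _),
    integral_finsetSum _ fun k _ => hX k, integral_const, probReal_univ, one_smul]
  refine sub_le_sub_right ?_ _
  refine (Finset.sum_le_sum fun k _ =>
    integral_cost_runLaw_le h hc hH hf hD hη hlam hl hu.1 k).trans ?_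
  rw [Finset.sum_add_distrib, ← integral_finsetSum _ fun k _ => hY k]
  refine add_le_add ?_ le_rfl
  refine (integral_mono (integrable_finsetSum _ fun k _ => hY k) (integrable_const _) fun ω =>
    h.sum_omdGain_le hη (by linarith) hc hu K ω).trans (by simp)

end

/-! ### Tuning of the constants and conclusion -/

section

/-- With `R = √(D * τ * SA * K)` the learning rate is `SA / R`. The divergence gives `2 * R * L`,
the skew at most `24 * R`, and the additive constant at most `3 * R`, which add up to `29`. -/
theorem two_mul_div_add_le {SA D τ K t η L ε : ℝ} (hSA : 1 ≤ SA) (hD : 1 ≤ D) (ht : 1 ≤ t)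
    (hτ : t ≤ τ) (hK : 1 ≤ K) (hη : η = √(SA / (D * τ * K))) (hL : 1 ≤ L) (hε : ε ≤ L) :
    (SA + 1) / η * ε + 3 * (8 * η * (K * D * t)) + 3 ≤ 29 * √(D * τ * SA * K) * L := by
  have hτ1 : 1 ≤ τ := ht.trans hτ
  set R := √(D * τ * SA * K) with hR
  have hx : 1 ≤ D * τ * SA * K :=
    one_le_mul_of_one_le_of_one_le (one_le_mul_of_one_le_of_one_le
      (one_le_mul_of_one_le_of_one_le hD hτ1) hSA) hK
  have hR1 : 1 ≤ R := Real.one_le_sqrt.2 hx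
  have hR2 : R ^ 2 = D * τ * SA * K := Real.sq_sqrt (by positivity)
  have hηR : η = SA / R := by
    rw [eq_div_iff (by positivity), hη, hR, ← Real.sqrt_mul (by positivity)]
    have e : SA / (D * τ * K) * (D * τ * SA * K) = SA ^ 2 := by field_simp
    rw [e, Real.sqrt_sq (by positivity)]
  have hη0 : 0 < η := by rw [hηR]; positivity
  have h1 : (SA + 1) / η * ε ≤ 2 * R * L := by
    have h2 : (SA + 1) / η ≤ 2 * R := by
      rw [div_le_iff₀ hη0, hηR]
      field_simp
      linarith
    refine (mul_le_mul_of_nonneg_left hε (by positivity)).trans ?_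
    exact mul_le_mul_of_nonneg_right h2 (by positivity)
  have h2 : η * (K * D * t) ≤ R := by
    have h3 : η * (K * D * τ) = R := by
      rw [hηR, div_mul_eq_mul_div, div_eq_iff (by positivity), ← pow_two, hR2]
      ring
    rw [← h3]
    gcongr
  have h4 : R ≤ R * L := le_mul_of_one_le_right (by positivity) hL
  linarith

theorem regret_bound {S : Type u} {A : S → Type v} [Fintype S] [∀ s, Fintype (A s)] (M : MDP S A)
    (K H₁ H₂ : ℕ) (T τ η lam D SA : ℝ) (πf : (s : S) → A s) (q₁ : Occ A)
    (upd : Occ A → (Option (Σ s, A s) → ℝ) → Occ A) (hD : D = M.diameter.toReal)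
    (hSA : SA = Fintype.card (Σ s, A s)) (hg : M.IsFast πf) (hDH : D ≤ H₂)
    (hK : 64 * SA * ((H₁ : ℝ) + H₂) ^ 2 ≤ K) (hη : η = √(SA / (D * τ * K))) (hlam : lam = 8 * η)
    (hO : IsOMD M H₁ H₂ T η lam q₁ upd) (c : ℕ → (Σ s, A s) → ℝ)
    (hc : ∀ k γ, c k γ ∈ Set.Icc (0 : ℝ) 1) (f : (s : S) → A s) (t : ℝ) (hf : M.IsBest c K f)
    (ht : t = (M.hittingTime f M.s₀).toReal) (hT : t + 1 ≤ T) (hτ : t ≤ τ)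
    (hlog : ∀ s, 8 * (M.hittingTime f s).toReal * Real.log K ≤ H₁) :
    (∀ᵐ ω ∂runLaw M H₁ H₂ πf q₁ upd c, ∀ k < K, ∃ i, ω k i = none) ∧
    Integrable (M.regret c K f) (runLaw M H₁ H₂ πf q₁ upd c) ∧
    ∫ ω, M.regret c K f ω ∂runLaw M H₁ H₂ πf q₁ upd c
      ≤ 29 * √(D * τ * SA * K) * Real.log (T * K) := by
  simp only [hf.1.toReal_hittingTime] at hlog ht
  have ht1 : 1 ≤ t := ht ▸ hf.1.one_le_value M.s₀
  have hτ1 : 1 ≤ τ := ht1.trans hτ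
  have hD1 : 1 ≤ D := hD ▸ (hg.1.one_le_value M.s₀).trans (hg.value_le_diameter M.s₀)
  have hSA1 : 1 ≤ SA := by
    have : Nonempty (Σ s, A s) := ⟨⟨M.s₀, f M.s₀⟩⟩
    rw [hSA]
    exact_mod_cast Fintype.card_pos
  have hH1 : (1 : ℝ) ≤ (H₁ : ℝ) + H₂ := by
    linarith [(Nat.cast_nonneg H₁ : (0 : ℝ) ≤ H₁)]
  set H := (H₁ : ℝ) + H₂ with hHdef
  have hK1 : 64 * H ^ 2 ≤ K := by
    refine le_trans ?_ hK
    nlinarith [sq_nonneg H]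
  have hK2 : 64 * H ≤ K := by nlinarith
  have hK64 : (64 : ℝ) ≤ K := by linarith
  have hKn : 64 ≤ K := by exact_mod_cast hK64
  have hlogK : 1 ≤ Real.log K := by
    rw [Real.le_log_iff_exp_le (by linarith)]
    linarith [Real.exp_one_lt_d9]
  -- The logarithmic lower bound on `H₁` forces this, since the hitting time and `log K` are at
  -- least `1`.
  have hH : 0 < H₁ := by
    have h1 := hlog M.s₀
    rw [← ht] at h1
    have h2 : (0 : ℝ) < H₁ := by nlinarith
    exact_mod_cast h2
  have hη0 : 0 < η := by
    rw [hη]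
    exact Real.sqrt_pos.2 (by positivity)
  have hlam0 : 0 ≤ lam := by rw [hlam]; positivity
  -- `(lam * H) ^ 2 = 64 * η ^ 2 * H ^ 2 ≤ 64 * SA * H ^ 2 / K`, because `D * τ ≥ 1`; the lower
  -- bound on `K` is chosen for this.
  have hl : lam * H ≤ 1 := by
    have h1 : (lam * H) ^ 2 ≤ 1 := by
      rw [hlam, mul_pow, mul_pow, hη, Real.sq_sqrt (by positivity)]
      have h2 : SA / (D * τ * K) ≤ SA / K := by
        refine div_le_div_of_nonneg_left (by positivity) (by positivity) ?_
        exact le_mul_of_one_le_left (by positivity) (one_le_mul_of_one_le_of_one_le hD1 hτ1)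
      have h3 : SA / K * (64 * H ^ 2) ≤ 1 := by
        rw [div_mul_eq_mul_div, div_le_one (by positivity)]
        linarith
      nlinarith [sq_nonneg H]
    nlinarith
  refine ⟨ae_all_iff.2 fun k => ?_, integrable_regret hO hc hH hg (hD ▸ hDH) K f, ?_⟩
  · filter_upwards [ae_reaches_runLaw hO hc hH hg (hD ▸ hDH) k] with ω hω _ using hω
  have hTK : 1 < T * K := by nlinarith
  have hε : 0 < 1 / (T * K) := by positivity
  have hε1 : 1 / (T * K) ≤ 1 := by rw [div_le_one (by positivity)]; exact hTK.le
  have hqs : IsLoopFreeOcc M H₁ H₂ T (policyOcc M H₁ H₂ (detPolicy f)) :=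
    hf.1.isLoopFreeOcc_policyOcc hH (by omega)
      (by linarith [(Nat.cast_nonneg H₁ : (0 : ℝ) ≤ H₁)]) hlog (ht ▸ hT)
  -- The best policy may miss active pairs, where its barrier is infinite. The share `1 / (T * K)`
  -- of `q₁` repairs this, and its skewed cost over all episodes is at most `2`.
  have hu : mix (1 - 1 / (T * K)) q₁ (policyOcc M H₁ H₂ (detPolicy f)) ∈ Feasible M H₁ H₂ T :=
    mix_mem_Feasible hO.init_mem hqs (by linarith) (by linarith)
  have h1 := integral_regret_le hO hc hH hg (hD ▸ hDH) hη0 hlam hl hu K f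
  have h2 := barrierDiv_init_le hη0 hlam0 hO.init hO.init_mem hu hε hε1 fun γ => by
    rw [marginal_skew_mix]
    have := (hqs.marginal_nonneg γ).trans (hqs.marginal_le_skew hlam0 γ)
    nlinarith [mul_nonneg (sub_nonneg.2 hε1) this]
  have h3 := hf.sum_skew_mix_le (T := T) hlam0 hl hc hg (hD ▸ hDH) hH (by omega) (by linarith) hlog
    (ht ▸ hT) hO.init_mem.1
  rw [one_div_one_div, ← hSA] at h2
  rw [← hD, ← ht, hlam] at h3
  have hL : 1 ≤ Real.log (T * K) := by
    refine hlogK.trans (Real.log_le_log (by linarith) ?_)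
    nlinarith
  have h4 := two_mul_div_add_le (D := D) (K := K) hSA1 hD1 ht1 hτ (by linarith) hη hL le_rfl
  rw [hlam] at h1 h2
  linarith

end

end SSP

end

theorem mainTheorem6 :
    ∃ C : ℝ, 0 < C ∧
      ∀ (S : Type*) (A : S → Type*) [Fintype S] [∀ s, Fintype (A s)] (M : SSP.MDP S A)
        (K H₁ H₂ : ℕ) (T τ η lam D SA : ℝ) (πf : (s : S) → A s) (q₁ : SSP.Occ A)
        (upd : SSP.Occ A → (Option (Σ s, A s) → ℝ) → SSP.Occ A),
        -- the diameter, and the number of states times the average number of actions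
        D = M.diameter.toReal →
        SA = Fintype.card (Σ s, A s) →
        -- the learner
        M.IsFast πf →
        D ≤ H₂ →
        64 * SA * ((H₁ : ℝ) + H₂) ^ 2 ≤ K →
        η = √(SA / (D * τ * K)) →
        lam = 8 * η →
        SSP.IsOMD M H₁ H₂ T η lam q₁ upd →
        -- the oblivious adversary and the best policy in hindsight
        ∀ c : ℕ → (Σ s, A s) → ℝ, (∀ k γ, c k γ ∈ Set.Icc (0 : ℝ) 1) →
        ∀ (πstar : (s : S) → A s) (Tstar : ℝ),
        M.IsBest c K πstar →
        Tstar = (M.hittingTime πstar M.s₀).toReal →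
        Tstar + 1 ≤ T →
        Tstar ≤ τ →
        (∀ s, 8 * (M.hittingTime πstar s).toReal * Real.log K ≤ H₁) →
        (∀ᵐ ω ∂SSP.runLaw M H₁ H₂ πf q₁ upd c, ∀ k < K, ∃ i, ω k i = none) ∧
        MeasureTheory.Integrable (M.regret c K πstar) (SSP.runLaw M H₁ H₂ πf q₁ upd c) ∧
        ∫ ω, M.regret c K πstar ω ∂SSP.runLaw M H₁ H₂ πf q₁ upd c
          ≤ C * √(D * τ * SA * K) * Real.log (T * K) := by
  refine ⟨29, by norm_num, ?_⟩
  intro S A _ _ M K H₁ H₂ T τ η lam D SA πf q₁ upd hD hSA hg hDH hK hη hlam hO c hc f t hf ht hT hτ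
    hlog
  exact SSP.regret_bound M K H₁ H₂ T τ η lam D SA πf q₁ upd hD hSA hg hDH hK hη hlam hO c hc f t hf
    ht hT hτ hlog
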